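/- Let $\kappa$ be a cardinal. An $\Omega_\kappa$ system $\mathcal G$ consists, for each $\alpha<\kappa$, of an inverse sequence $\mathcal G_\alpha=\langle G_{\alpha,k},\,p_{\alpha,j,k}\colon G_{\alpha,j}\to G_{\alpha,k}\ (j\ge k)\rangle$ of abelian groups indexed by $\omega$. It gives inverse systems $G\subseteq\overline G$ indexed by $\omega^\kappa$ (ordered pointwise), $G_x=\bigoplus_{\alpha<\kappa}G_{\alpha,x(\alpha)}\subseteq\overline G_x=\prod_{\alpha<\kappa}G_{\alpha,x(\alpha)}$, with coordinatewise bonding maps $p_{y,x}$ for $x\le y$. A morphism of $\Omega_\kappa$ systems is a family of homomorphisms $\varphi_{\alpha,k}$ commuting with the structure maps; $\mathcal I$ is injective if for all morphisms $\varphi\colon\mathcal G\to\mathcal I$ and $\psi\colon\mathcal G\to\mathcal H$ with every $\psi_{\alpha,k}$ injective there is $\overline\varphi\colon\mathcal H\to\mathcal I$ with $\overline\varphi\psi=\varphi$. For an inverse system $\mathbf F$ of abelian groups over $\omega^\kappa$ let $K^n(\mathbf F)$ be the group of families $y\in\prod_{(x_0,\dots,x_n)\in(\omega^\kappa)^{n+1}}\mathbf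 F_{x_0\wedge\dots\wedge x_n}$ with $y(x_0,\dots,x_n)=\operatorname{sgn}(\sigma)\,y(x_{\sigma(0)},\dots,x_{\sigma(n)})$ for all permutations $\sigma$ of $\{0,\dots,n\}$, with coboundary $dy(x_0,\dots,x_{n+1})=\sum_i(-1)^i\,p\big(y(x_0,\dots,\widehat{x_i},\dots,x_{n+1})\big)$, where $p$ denotes the bonding map to $\mathbf F_{x_0\wedge\dots\wedge x_{n+1}}$. For $n\ge1$, an $n$-coherent family for $\mathcal G$ is a $\Phi\in K^{n-1}(\overline G)$ with $d\Phi\in K^n(G)$. Write $a=^*b$ if two elements of some $\overline G_x$ differ in only finitely many coordinates $\alpha<\kappa$. The family $\Phi$ is $n$-trivial if - for $n=1$: there is $\psi\in\lim\overline G$ such that $\Phi(f)=^*\psi_f$ for all $f\in\omega^\kappa$, where $\psi_f\in\overline G_f$ is the component of $\psi$ at $f$; - for $n>1$: there is $\Psi\in K^{n-2}(\overline G)$ such that $\Phi(\vec f)=^*(d\Psi)(\vec f)$ for all $\vec f\in(\omega^\kappa)^n$. **Lemma.** Suppose that for every injective $\Omega_\kappa$ system $\mathcal I$ and every $n\ge1$,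 every $n$-coherent family for $\mathcal I$ is $n$-trivial. Then for every $\Omega_\kappa$ system $\mathcal G$ and every $n\ge0$ the canonical map $$\bigoplus_{\alpha<\kappa}\lim{}^n\,\mathcal G_\alpha\longrightarrow\lim{}^n\,G$$ is an isomorphism. Here $\lim^n$ is the $n$-th right derived functor of the inverse limit functor on inverse systems of abelian groups over the relevant index set ($\omega$ on the left, $\omega^\kappa$ on the right), and the component of the map at $\alpha$ is the composite of the comparison map from $\lim^n\mathcal G_\alpha$ to $\lim^n$ of the pulled back system $x\mapsto G_{\alpha,x(\alpha)}$ over $\omega^\kappa$ with the map induced by the inclusions $G_{\alpha,x(\alpha)}\to G_x$ of summands. -/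

import Mathlib

open CategoryTheory CategoryTheory.Limits Opposite

universe u w w'

/- Posets of functions are regarded as categories through their order. -/
attribute [-instance] CategoryTheory.pi

namespace OmegaKappa

noncomputable section

/-! ### Inverse systems of abelian groups and their derived limits -/

/-- An inverse system of abelian groups indexed over the preorder `P`: groups `F.obj (op x)` and
compatible homomorphisms `F.obj (op y) ⟶ F.obj (op x)` for `x ≤ y`. -/
abbrev InvSystem (P : Type w) [Preorder P] := Pᵒᵖ ⥤ AddCommGrpCat.{u}

instance (P : Type u) [Preorder P] : IsGrothendieckAbelian.{u} (InvSystem.{u} P) where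
  ab5OfSize := { ofShape := fun _ _ _ => inferInstance }

instance : IsGrothendieckAbelian.{u} (InvSystem.{u} ℕ) where
  ab5OfSize := { ofShape := fun _ _ _ => inferInstance }

instance (P : Type w) [Preorder P] [HasLimitsOfShape Pᵒᵖ AddCommGrpCat.{u}] :
    (lim : InvSystem.{u} P ⥤ AddCommGrpCat.{u}).Additive where
  map_add := by
    intro X Y f g
    apply limit.hom_ext
    intro j
    simp [Preadditive.add_comp, Preadditive.comp_add]

/-- `lim^n`: the `n`-th right derived functor of the inverse limit functor on the abelian category
of inverse systems of abelian groups indexed over `P`. -/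
def derivedLim (P : Type w) [Preorder P] [HasLimitsOfShape Pᵒᵖ AddCommGrpCat.{u}]
    [EnoughInjectives (InvSystem.{u} P)] (n : ℕ) : InvSystem.{u} P ⥤ AddCommGrpCat.{u} :=
  (lim : InvSystem.{u} P ⥤ AddCommGrpCat.{u}).rightDerived n

/-- The bonding map `F_y → F_x` of an inverse system, for `x ≤ y`. -/
def InvSystem.bond {P : Type w} [Preorder P] (F : InvSystem.{u} P) {x y : P} (h : x ≤ y) :
    F.obj (op y) →+ F.obj (op x) :=
  (F.map (homOfLE h).op).hom

section Pullback

variable {P : Type w} {Q : Type w'} [Preorder P] [Preorder Q]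

/-- Reindexing an inverse system over `Q` along a monotone map `e : P → Q`: the system
`x ↦ F_{e x}` over `P`. -/
abbrev pullback (e : P →o Q) : InvSystem.{u} Q ⥤ InvSystem.{u} P :=
  (Functor.whiskeringLeft _ _ _).obj e.monotone.functor.op

variable (e : P →o Q)

/-- If `e` has a lower adjoint `s`, then reindexing along `e` is right adjoint to reindexing along
`s`. -/
def pullbackAdjunction (s : Q →o P) (hs : GaloisConnection s e) :
    pullback.{u} s ⊣ pullback.{u} e :=
  Adjunction.whiskerLeft _ hs.adjunction.op

/-- Reindexing along `e` is exact and, when `e` has a lower adjoint, preserves injective objects;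
hence it takes an injective resolution of `F` to an injective resolution of the reindexed
system. -/
def pullbackResolution (s : Q →o P) (hs : GaloisConnection s e) {F : InvSystem.{u} Q}
    (I : InjectiveResolution F) : InjectiveResolution ((pullback e).obj F) where
  cocomplex := ((pullback e).mapHomologicalComplex _).obj I.cocomplex
  injective n := Injective.injective_of_adjoint (pullbackAdjunction e s hs) (I.cocomplex.X n)
  ι := ((HomologicalComplex.singleMapHomologicalComplex (pullback e) _ 0).inv.app F) ≫
    ((pullback e).mapHomologicalComplex _).map I.ι
  quasiIso := inferInstance

variable [HasLimitsOfShape Pᵒᵖ AddCommGrpCat.{u}] [HasLimitsOfShape Qᵒᵖ AddCommGrpCat.{u}]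

/-- The natural map `lim F → lim (e^* F)`, restricting a compatible family along `e`. -/
def limComparison :
    (lim : InvSystem.{u} Q ⥤ AddCommGrpCat.{u}) ⟶ pullback e ⋙ lim where
  app F := limit.pre F e.monotone.functor.op
  naturality F G f := by
    apply limit.hom_ext
    intro j
    let E := e.monotone.functor.op
    calc (limMap f ≫ limit.pre G E) ≫ limit.π (E ⋙ G) j
        = limMap f ≫ limit.π G (E.obj j) := by rw [Category.assoc, limit.pre_π]
      _ = limit.π F (E.obj j) ≫ f.app (E.obj j) := limMap_π _ _
      _ = limit.pre F E ≫ limit.π (E ⋙ F) j ≫ f.app (E.obj j) := by rw [limit.pre_π_assoc]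
      _ = (limit.pre F E ≫ limMap (E.whiskerLeft f)) ≫ limit.π (E ⋙ G) j := by
        rw [Category.assoc, limMap_π]; rfl

variable [EnoughInjectives (InvSystem.{u} P)] [EnoughInjectives (InvSystem.{u} Q)]

/-- The natural map `lim^n F → lim^n (e^* F)`: for an injective resolution `I` of `F`, it is
induced on cohomology by the map of complexes `lim I → lim (e^* I)`. -/
def derivedLimComparison (s : Q →o P) (hs : GaloisConnection s e) (n : ℕ) (F : InvSystem.{u} Q) :
    (derivedLim Q n).obj F ⟶ (derivedLim P n).obj ((pullback e).obj F) :=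
  ((injectiveResolution F).isoRightDerivedObj lim n).hom ≫
    (HomologicalComplex.homologyFunctor _ _ n).map
      ((NatTrans.mapHomologicalComplex (limComparison e) _).app
        (injectiveResolution F).cocomplex) ≫
    ((pullbackResolution e s hs (injectiveResolution F)).isoRightDerivedObj lim n).inv

end Pullback

/-! ### `Ω_κ` systems -/

/-- An `Ω_κ` system: for every `α < κ` an inverse sequence of abelian groups
`𝒢_α = (G_{α,k}, p_{α,j,k})`, where `G_{α,k}` is `(𝒢 α).obj (op k)`. -/
abbrev OmegaSystem (κ : Type u) := κ → InvSystem.{u} ℕ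

/-- The subgroup of finitely supported elements of a product, that is, the direct sum regarded as
a subset of the product. -/
def finSupp {κ : Type u} (M : κ → Type u) [∀ α, AddCommGroup (M α)] :
    AddSubgroup (∀ α, M α) where
  carrier := {y | {α | y α ≠ 0}.Finite}
  zero_mem' := by simp
  add_mem' := by
    intro a b ha hb
    refine (ha.union hb).subset ?_
    intro α hα
    by_contra h
    simp only [Set.mem_union, Set.mem_ofPred_eq, not_or, not_not] at h
    exact hα (by simp [h.1, h.2])
  neg_mem' := by
    intro a ha
    simpa using ha

variable {κ : Type u}

/-- The map `p_{y,x} = ∏_α p_{α,y(α),x(α)}` for `x ≤ y` in `ω^κ`. -/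
def prodBond (𝒢 : OmegaSystem κ) {x y : κ → ℕ} (h : x ≤ y) :
    (∀ α, (𝒢 α).obj (op (y α))) →+ ∀ α, (𝒢 α).obj (op (x α)) :=
  AddMonoidHom.mk' (fun g α => (𝒢 α).bond (h α) (g α)) (by intro a b; ext α; simp)

/-- The inverse system `Ḡ` over `ω^κ`, with `Ḡ_x = ∏_α G_{α,x(α)}`. -/
def prodSystem (𝒢 : OmegaSystem κ) : InvSystem.{u} (κ → ℕ) where
  obj x := AddCommGrpCat.of (∀ α, (𝒢 α).obj (op (x.unop α)))
  map f := AddCommGrpCat.ofHom (prodBond 𝒢 (leOfHom f.unop))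
  map_id x := by
    ext g α
    exact congrArg (fun h => h.hom (g α)) ((𝒢 α).map_id (op (x.unop α)))
  map_comp {x y z} f g := by
    ext a α
    exact congrArg (fun h => h.hom (a α)) ((𝒢 α).map_comp
      (homOfLE (leOfHom f.unop α)).op (homOfLE (leOfHom g.unop α)).op)

theorem prodBond_mem (𝒢 : OmegaSystem κ) {x y : κ → ℕ} (h : x ≤ y)
    (g : finSupp fun α => (𝒢 α).obj (op (y α))) :
    prodBond 𝒢 h g.1 ∈ finSupp fun α => (𝒢 α).obj (op (x α)) := by
  refine Set.Finite.subset g.2 ?_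
  intro α hα h0
  exact hα ((congrArg ((𝒢 α).bond (h α)) h0).trans (map_zero _))

/-- The inverse system `G` over `ω^κ`, with `G_x = ⨁_α G_{α,x(α)} ⊆ Ḡ_x`. -/
def sumSystem (𝒢 : OmegaSystem κ) : InvSystem.{u} (κ → ℕ) where
  obj x := AddCommGrpCat.of (finSupp fun α => (𝒢 α).obj (op (x.unop α)))
  map f := AddCommGrpCat.ofHom
    (((prodBond 𝒢 (leOfHom f.unop)).comp (AddSubgroup.subtype _)).codRestrict _
      (prodBond_mem 𝒢 (leOfHom f.unop)))
  map_id x := by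
    ext g α
    exact congrArg (fun h => h.hom g.1 α) ((prodSystem 𝒢).map_id x)
  map_comp {x y z} f g := by
    ext a α
    exact congrArg (fun h => h.hom a.1 α) ((prodSystem 𝒢).map_comp f g)

/-- The inclusion `G ⊆ Ḡ`. -/
def sumToProd (𝒢 : OmegaSystem κ) : sumSystem 𝒢 ⟶ prodSystem 𝒢 where
  app x := AddCommGrpCat.ofHom (AddSubgroup.subtype _)

/-- A morphism `φ : 𝒢 → ℋ` of `Ω_κ` systems consists of homomorphisms `φ_{α,k}` commuting with the
structure maps. The system `ℐ` is injective if every morphism `φ : 𝒢 → ℐ` extends along every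
morphism `ψ : 𝒢 → ℋ` all of whose components are injective. -/
def OmegaSystem.IsInjective (ℐ : OmegaSystem κ) : Prop :=
  ∀ (𝒢 ℋ : OmegaSystem κ) (φ : ∀ α, 𝒢 α ⟶ ℐ α) (ψ : ∀ α, 𝒢 α ⟶ ℋ α),
    (∀ α k, Function.Injective ((ψ α).app (op k))) →
    ∃ φ' : ∀ α, ℋ α ⟶ ℐ α, ∀ α, ψ α ≫ φ' α = φ α

/-! ### The alternating cochain complex, coherence and triviality -/

section Cochains

variable {P : Type w} [SemilatticeInf P]

/-- The meet `⋀ x_i` of a nonempty finite tuple. -/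
def meet {n : ℕ} (x : Fin (n + 1) → P) : P :=
  Finset.univ.inf' Finset.univ_nonempty x

theorem meet_le_meet_comp {m n : ℕ} (x : Fin (n + 1) → P) (g : Fin (m + 1) → Fin (n + 1)) :
    meet x ≤ meet (x ∘ g) :=
  Finset.le_inf' _ _ fun i _ => Finset.inf'_le x (Finset.mem_univ (g i))

/-- Families `y(x_0, …, x_n) ∈ F_{⋀ x_i}`. -/
abbrev Cochain (F : InvSystem.{u} P) (n : ℕ) : Type _ :=
  ∀ x : Fin (n + 1) → P, F.obj (op (meet x))

/-- The group `K^n(F)` of alternating cochains: `y(x_0, …, x_n) = sgn(σ) y(x_{σ(0)}, …, x_{σ(n)})`.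
(The bonding map only identifies the groups at the equal indices `⋀ x_{σ(i)} = ⋀ x_i`.) -/
def altCochains (F : InvSystem.{u} P) (n : ℕ) : AddSubgroup (Cochain F n) where
  carrier := {y | ∀ (σ : Equiv.Perm (Fin (n + 1))) (x : Fin (n + 1) → P),
    y x = (Equiv.Perm.sign σ : ℤ) • F.bond (meet_le_meet_comp x σ) (y (x ∘ σ))}
  zero_mem' := by intro σ x; simp
  add_mem' := by
    intro a b ha hb σ x
    rw [Pi.add_apply, Pi.add_apply, map_add, smul_add, ← ha σ x, ← hb σ x]
  neg_mem' := by
    intro a ha σ x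
    rw [Pi.neg_apply, Pi.neg_apply, map_neg, smul_neg, ← ha σ x]

/-- The coboundary
`(dy)(x_0, …, x_{n+1}) = ∑_i (-1)^i p(y(x_0, …, x̂_i, …, x_{n+1})) ∈ F_{⋀ x_j}`. -/
def coboundary (F : InvSystem.{u} P) {n : ℕ} (y : Cochain F n) : Cochain F (n + 1) :=
  fun x => ∑ i : Fin (n + 2),
    ((-1) ^ (i : ℕ) : ℤ) • F.bond (meet_le_meet_comp x i.succAbove) (y (x ∘ i.succAbove))

end Cochains

/-- `Φ ∈ K^m(Ḡ)` is an `(m+1)`-coherent family if `dΦ ∈ K^{m+1}(G)`. -/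
def IsCoherent (𝒢 : OmegaSystem κ) (m : ℕ) (Φ : Cochain (prodSystem 𝒢) m) : Prop :=
  Φ ∈ altCochains (prodSystem 𝒢) m ∧
    ∃ Θ ∈ altCochains (sumSystem 𝒢) (m + 1),
      ∀ x, coboundary (prodSystem 𝒢) Φ x = (sumToProd 𝒢).app (op (meet x)) (Θ x)

/-- `a =^* b`: two elements of `Ḡ_x` agree at all but finitely many coordinates `α < κ`. -/
def EqMod (𝒢 : OmegaSystem κ) {x : κ → ℕ} (a b : ∀ α, (𝒢 α).obj (op (x α))) : Prop :=
  {α | a α ≠ b α}.Finite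

/-- `Φ ∈ K^m(Ḡ)` is `(m+1)`-trivial: for `m = 0` there is `ψ ∈ lim Ḡ` with `Φ_f =^* p_f ψ` for all
`f`; for `m > 0` there is `Ψ ∈ K^{m-1}(Ḡ)` with `Φ(x) =^* (dΨ)(x)` for all tuples `x`. -/
def IsTrivial (𝒢 : OmegaSystem κ) : (m : ℕ) → Cochain (prodSystem 𝒢) m → Prop
  | 0, Φ => ∃ ψ : ∀ f : κ → ℕ, (prodSystem 𝒢).obj (op f),
      (∀ (f g : κ → ℕ) (h : f ≤ g), (prodSystem 𝒢).bond h (ψ g) = ψ f) ∧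
      ∀ x, EqMod 𝒢 (Φ x) (ψ (meet x))
  | m + 1, Φ => ∃ Ψ ∈ altCochains (prodSystem 𝒢) m,
      ∀ x, EqMod 𝒢 (Φ x) (coboundary (prodSystem 𝒢) Ψ x)

/-! ### The canonical map `⨁_α lim^n 𝒢_α → lim^n G` -/

/-- Evaluation at `α`, as a monotone map `ω^κ → ω`. -/
def evalAt (α : κ) : (κ → ℕ) →o ℕ where
  toFun x := x α
  monotone' _ _ h := h α

open Classical in
/-- The function `ω → ω^κ` sending `k` to the function with value `k` at `α` and `0` elsewhere. -/
def singleAt (α : κ) : ℕ →o (κ → ℕ) where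
  toFun k := (Pi.single α k : κ → ℕ)
  monotone' _ _ h := Pi.single_mono α h

theorem singleAt_gc (α : κ) : GaloisConnection (singleAt α) (evalAt α) := by
  classical
  intro k x
  constructor
  · intro h
    have h1 : (Pi.single α k : κ → ℕ) α ≤ x α := h α
    rw [Pi.single_eq_same] at h1
    exact h1
  · intro h β
    change (Pi.single α k : κ → ℕ) β ≤ x β
    by_cases hβ : β = α
    · subst hβ
      rw [Pi.single_eq_same]
      exact h
    · rw [Pi.single_eq_of_ne hβ]
      exact Nat.zero_le _

open Classical in
theorem prodBond_single (𝒢 : OmegaSystem κ) {x y : κ → ℕ} (h : x ≤ y) (α : κ)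
    (g : (𝒢 α).obj (op (y α))) :
    prodBond 𝒢 h (Pi.single α g) = Pi.single α ((𝒢 α).bond (h α) g) := by
  funext β
  change (𝒢 β).bond (h β) (Pi.single (M := fun β => (𝒢 β).obj (op (y β))) α g β) = _
  by_cases hβ : β = α
  · subst hβ
    rw [Pi.single_eq_same, Pi.single_eq_same]
  · rw [Pi.single_eq_of_ne hβ, Pi.single_eq_of_ne hβ, map_zero]

open Classical in
/-- The inclusion of the `α`-th summand `G_{α,x(α)} → ⨁_β G_{β,x(β)}`, naturally in `x ∈ ω^κ`. -/
def summandInclusion (𝒢 : OmegaSystem κ) (α : κ) :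
    (pullback (evalAt α)).obj (𝒢 α) ⟶ sumSystem 𝒢 where
  app x := AddCommGrpCat.ofHom
    ((AddMonoidHom.single (fun β => (𝒢 β).obj (op (x.unop β))) α).codRestrict
      (finSupp fun β => (𝒢 β).obj (op (x.unop β))) (by
        intro g
        refine (Set.finite_singleton α).subset ?_
        intro β hβ
        by_contra h
        exact hβ (Pi.single_eq_of_ne h _)))
  naturality x y f := by
    refine AddCommGrpCat.hom_ext (AddMonoidHom.ext fun g => Subtype.ext ?_)
    exact (prodBond_single 𝒢 (leOfHom f.unop) α g).symm

/-- The component `lim^n 𝒢_α → lim^n G` of the canonical map. -/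
def canonicalComponent (𝒢 : OmegaSystem κ) (n : ℕ) (α : κ) :
    (derivedLim.{u} ℕ n).obj (𝒢 α) ⟶ (derivedLim (κ → ℕ) n).obj (sumSystem 𝒢) :=
  derivedLimComparison (evalAt α) (singleAt α) (singleAt_gc α) n (𝒢 α) ≫
    (derivedLim (κ → ℕ) n).map (summandInclusion 𝒢 α)

open Classical in
/-- The canonical map `⨁_α lim^n 𝒢_α → lim^n G`. -/
def canonicalMap (𝒢 : OmegaSystem κ) (n : ℕ) :
    (DirectSum κ fun α => (derivedLim.{u} ℕ n).obj (𝒢 α)) →+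
      (derivedLim (κ → ℕ) n).obj (sumSystem 𝒢) :=
  DirectSum.toAddMonoid fun α => (canonicalComponent 𝒢 n α).hom

end

end OmegaKappa

/-!
Why the canonical map is an isomorphism. Choose injective resolutions `I_α` of the sequences `𝒢_α`
and `R` of the system `G`. The systems `S^n = ⨁_α I_α^n` (the systems `G` of the `Ω_κ` systems
`(I_α^n)_α`) form a resolution of `G`, and the morphisms of resolutions which lift the inclusions of
the summands add up to a morphism `S → R` over `G` (`sumResolutionDesc`). The canonical map is
induced by the maps `lim I_α → lim R` (`canonicalComponent_eq`), which factor through `lim S`, and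
`lim S` is the direct sum of the complexes `lim I_α` (`exists_eq_sum_limSummand`,
`eq_of_sum_limSummand_eq`). So it suffices that `lim S → lim R` is a quasi-isomorphism, and this
follows once the terms `S^n` are acyclic.

Acyclicity is expressed by cochains. The complex of alternating cochains `altCochains` is not an
exact functor of the inverse system, because an alternating cochain may take nonzero 2-torsion
values at tuples with repeated entries. The subcomplex `strictCochains` of cochains which vanish at
these tuples is exact (`exists_strictMap_eq`), and its `0`-cocycles are the elements of the inverse
limit. Call a system cochain-acyclic if this complex has no cohomology in positive degrees. Every
injective system `F` is cochain-acyclic: it is a direct summand of `x ↦ ∏_{q ≤ x} F_q`, for which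
the component at `q` of the cochain complex is contracted by coning off at `q`. A morphism between
cochain-acyclic resolutions of the same system gives a morphism of double complexes whose columns
are exact in positive degrees and whose rows have exact mapping cones; a zigzag
(`RowwiseQuasiIso.exists_closed_succ`) shows that it induces a quasi-isomorphism on inverse limits.

The hypothesis enters in `isCochainAcyclic_sumSystem`, for an `Ω_κ` system of injective sequences.
There `Ḡ` is cochain-acyclic, since reindexing along an evaluation `ω^κ → ω` preserves injectives.
Hence a cocycle with values in `G` is the coboundary of some `Φ` with values in `Ḡ`; this `Φ` is
coherent, so by hypothesis it differs from a cocycle by values in `G`. The difference is an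
alternating cochain with values in `G` and the same coboundary, and it becomes strictly alternating
when its values at tuples with repeated entries are replaced by zero
(`exists_strictCochain_of_altCochain`).
-/

namespace OmegaKappa

noncomputable section

/-! ### Alternating cochains with constant coefficients -/

section ConstantCoefficients

variable {V : Type*} {M : Type*} [AddCommGroup M]

/-- A function of tuples is alternating if permuting the arguments multiplies it by the sign. It
need not vanish on tuples with repeated entries: its values there may be nonzero 2-torsion. -/
def IsAlternating {n : ℕ} (c : (Fin n → V) → M) : Prop :=
  ∀ (σ : Equiv.Perm (Fin n)) (x : Fin n → V), c x = (Equiv.Perm.sign σ : ℤ) • c (x ∘ σ)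

/-- The coboundary of cochains with constant coefficients. -/
def constCoboundary {n : ℕ} (c : (Fin n → V) → M) (x : Fin (n + 1) → V) : M :=
  ∑ i : Fin (n + 1), ((-1) ^ (i : ℕ) : ℤ) • c (x ∘ i.succAbove)

theorem cons_comp_succAbove_zero {n : ℕ} (v : V) (x : Fin n → V) :
    (Fin.cons v x : Fin (n + 1) → V) ∘ (0 : Fin (n + 1)).succAbove = x := by
  funext j; simp

theorem cons_comp_succAbove_succ {n : ℕ} (v : V) (x : Fin (n + 1) → V) (i : Fin (n + 1)) :
    (Fin.cons v x : Fin (n + 2) → V) ∘ i.succ.succAbove = Fin.cons v (x ∘ i.succAbove) := by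
  funext j
  refine Fin.cases ?_ (fun k => ?_) j
  · simp
  · simp

/-- Coning off at `v` is a contracting homotopy of the cochains with constant coefficients. -/
theorem constCoboundary_cons {n : ℕ} (c : (Fin (n + 1) → V) → M) (v : V) (x : Fin (n + 1) → V) :
    constCoboundary c (Fin.cons v x) =
      c x - constCoboundary (fun z => c (Fin.cons v z)) x := by
  unfold constCoboundary
  rw [Fin.sum_univ_succ, cons_comp_succAbove_zero, sub_eq_add_neg, ← Finset.sum_neg_distrib]
  congr 1
  · simp
  · refine Finset.sum_congr rfl fun i _ => ?_
    rw [cons_comp_succAbove_succ]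
    simp [pow_succ]

theorem constCoboundary_sub {n : ℕ} (c c' : (Fin n → V) → M) :
    constCoboundary (fun x => c x - c' x) =
      fun x => constCoboundary c x - constCoboundary c' x := by
  funext x
  simp [constCoboundary, smul_sub]

/-- `d² = 0`, by induction on the degree: the coning homotopy reduces the identity for `c` to the
one for the cochain `z ↦ c (v, z)` of lower degree. -/
theorem constCoboundary_constCoboundary {n : ℕ} (c : (Fin n → V) → M) (x : Fin (n + 2) → V) :
    constCoboundary (constCoboundary c) x = 0 := by
  induction n with
  | zero =>
    have h : ∀ z : Fin 1 → V, constCoboundary c z = c Fin.elim0 := fun z => by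
      simp [constCoboundary, Subsingleton.elim _ (Fin.elim0 : Fin 0 → V)]
    rw [constCoboundary, Fin.sum_univ_two, h, h]
    simp
  | succ n ih =>
    obtain ⟨v, z, rfl⟩ : ∃ v z, x = Fin.cons v z := ⟨x 0, Fin.tail x, (Fin.cons_self_tail x).symm⟩
    rw [constCoboundary_cons]
    have h : (fun z => constCoboundary c (Fin.cons v z)) =
        fun z => c z - constCoboundary (fun z => c (Fin.cons v z)) z :=
      funext fun z => constCoboundary_cons c v z
    rw [h, constCoboundary_sub]
    simp [ih]

/-- Deleting the `j`-th entry after permuting by `σ` is the same as deleting the `σ j`-th entry and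
permuting the remaining ones by some `τ`. -/
theorem exists_perm_succAbove {n : ℕ} (σ : Equiv.Perm (Fin (n + 1))) (j : Fin (n + 1)) :
    ∃ τ : Equiv.Perm (Fin n), (∀ k, σ (j.succAbove k) = (σ j).succAbove (τ k)) ∧
      (Equiv.Perm.sign τ : ℤ) =
        (-1) ^ (j : ℕ) * (-1) ^ ((σ j : Fin (n + 1)) : ℕ) * (Equiv.Perm.sign σ : ℤ) := by
  -- Conjugating by the cycles that move `j` and `σ j` to the front gives a permutation fixing `0`.
  set ρ : Equiv.Perm (Fin (n + 1)) := (σ j).cycleRange * σ * (j.cycleRange)⁻¹ with hρ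
  obtain ⟨⟨p, τ⟩, hτ⟩ := Equiv.Perm.decomposeFin.symm.surjective ρ
  have h0 : ρ 0 = 0 := by
    simp [hρ, Equiv.Perm.inv_def]
  have hp : p = 0 := by
    rw [← hτ, Equiv.Perm.decomposeFin_symm_apply_zero] at h0
    exact h0
  subst hp
  have hs : ∀ k : Fin n, ρ k.succ = (τ k).succ := fun k => by
    rw [← hτ, Equiv.Perm.decomposeFin_symm_apply_succ]
    simp
  refine ⟨τ, fun k => ?_, ?_⟩
  · have h1 := hs k
    simp only [hρ, Equiv.Perm.mul_apply, Equiv.Perm.inv_def, Fin.cycleRange_symm_succ] at h1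
    rw [← Fin.cycleRange_symm_succ (σ j) (τ k), ← h1, Equiv.symm_apply_apply]
  · have h2 : Equiv.Perm.sign ρ = Equiv.Perm.sign τ := by
      rw [← hτ, Equiv.Perm.decomposeFin.symm_sign]
      simp
    rw [← h2, hρ]
    simp [Fin.sign_cycleRange]
    ring

theorem IsAlternating.constCoboundary {n : ℕ} {c : (Fin n → V) → M} (hc : IsAlternating c) :
    IsAlternating (constCoboundary c) := by
  intro σ x
  rw [OmegaKappa.constCoboundary, OmegaKappa.constCoboundary, Finset.smul_sum,
    ← Equiv.sum_comp σ]
  refine Finset.sum_congr rfl fun j _ => ?_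
  obtain ⟨τ, h1, h2⟩ := exists_perm_succAbove σ j
  have h3 : (x ∘ σ) ∘ j.succAbove = (x ∘ (σ j).succAbove) ∘ τ := by
    funext k
    simp [h1 k]
  rw [h3, hc τ (x ∘ (σ j).succAbove), h2, smul_smul, smul_smul]
  congr 1
  have e1 : ((-1 : ℤ) ^ ((σ j : Fin (n + 1)) : ℕ)) * (-1) ^ ((σ j : Fin (n + 1)) : ℕ) = 1 := by
    rw [← mul_pow]; simp
  linear_combination ((-1 : ℤ) ^ (j : ℕ) * (Equiv.Perm.sign σ : ℤ)) * e1

/-- If `c` is alternating and vanishes on tuples with repeated entries, then so does `d c`: when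
the repeated entries stand first, their two faces cancel and all others vanish. -/
theorem constCoboundary_eq_zero_of_not_injective {n : ℕ} {c : (Fin n → V) → M}
    (hc : IsAlternating c) (h0 : ∀ x, ¬ Function.Injective x → c x = 0) (x : Fin (n + 1) → V)
    (hx : ¬ Function.Injective x) : constCoboundary c x = 0 := by
  have key : ∀ (m : ℕ) (c : (Fin (m + 1) → V) → M), (∀ x, ¬ Function.Injective x → c x = 0) →
      ∀ x : Fin (m + 2) → V, x 0 = x 1 → constCoboundary c x = 0 := by
    intro m c h0 x hx
    rw [OmegaKappa.constCoboundary, Fin.sum_univ_succ, Fin.sum_univ_succ, Finset.sum_eq_zero]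
    · have h1 : x ∘ (0 : Fin (m + 2)).succAbove = x ∘ (Fin.succ 0 : Fin (m + 2)).succAbove := by
        funext k
        refine Fin.cases ?_ (fun l => ?_) k
        · simp [hx]
        · simp
      rw [h1]
      simp
    · intro i _
      rw [h0, smul_zero]
      intro hinj
      have h2 : (0 : Fin (m + 1)) ≠ i.succ := (Fin.succ_ne_zero i).symm
      cases m with
      | zero => exact i.elim0
      | succ m =>
        have h3 : (0 : Fin (m + 2)) = 1 := hinj (by
          simp only [Function.comp_apply]
          have e0 : (i.succ.succ : Fin (m + 3)).succAbove 0 = 0 := by simp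
          have e1 : (i.succ.succ : Fin (m + 3)).succAbove 1 = 1 := by simp
          rw [e0, e1]
          exact hx)
        exact absurd h3 (by simp)
  rw [Function.not_injective_iff] at hx
  obtain ⟨i, j, hij, hne⟩ := hx
  cases n with
  | zero => exact absurd (Subsingleton.elim (α := Fin 1) i j) hne
  | succ m =>
    obtain ⟨σ, hσ0, hσ1⟩ : ∃ σ : Equiv.Perm (Fin (m + 2)), σ 0 = i ∧ σ 1 = j := by
      let τ := Equiv.swap 0 i
      refine ⟨τ * Equiv.swap 1 (τ.symm j), ?_, ?_⟩
      · have h : (0 : Fin (m + 2)) ≠ τ.symm j := by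
          intro h
          apply hne
          rw [← Equiv.apply_symm_apply τ j, ← h]
          simp [τ]
        rw [Equiv.Perm.mul_apply, Equiv.swap_apply_of_ne_of_ne (by simp) h]
        simp [τ]
      · simp [Equiv.Perm.mul_apply]
    rw [hc.constCoboundary σ x, key m c h0 (x ∘ σ) (by simp [hσ0, hσ1, hij]), smul_zero]

/-- Coning preserves alternation. -/
theorem IsAlternating.cons {n : ℕ} {c : (Fin (n + 1) → V) → M} (hc : IsAlternating c) (v : V) :
    IsAlternating fun z : Fin n → V => c (Fin.cons v z) := by
  intro σ x
  have h : (Fin.cons v (x ∘ σ) : Fin (n + 1) → V) =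
      Fin.cons v x ∘ (Equiv.Perm.decomposeFin.symm (0, σ)) := by
    funext k
    refine Fin.cases ?_ (fun l => ?_) k
    · simp
    · simp
  change c (Fin.cons v x) = _ • c (Fin.cons v (x ∘ σ))
  rw [h, hc (Equiv.Perm.decomposeFin.symm (0, σ)) (Fin.cons v x),
    Equiv.Perm.decomposeFin.symm_sign]
  simp

end ConstantCoefficients

/-! ### Strictly alternating cochains -/

theorem InvSystem.bond_bond {P : Type w} [Preorder P] (F : InvSystem.{u} P) {x y z : P}
    (h : x ≤ y) (h' : y ≤ z) (a : F.obj (op z)) : F.bond h (F.bond h' a) = F.bond (h.trans h') a :=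
  (congrArg (fun t => t.hom a) (F.map_comp (homOfLE h').op (homOfLE h).op)).symm

theorem InvSystem.bond_self {P : Type w} [Preorder P] (F : InvSystem.{u} P) {x : P}
    (h : x ≤ x) (a : F.obj (op x)) : F.bond h a = a :=
  congrArg (fun t => t.hom a) (F.map_id (op x))

theorem InvSystem.app_bond {P : Type w} [Preorder P] {F G : InvSystem.{u} P} (φ : F ⟶ G) {x y : P}
    (h : x ≤ y) (a : F.obj (op y)) : φ.app (op x) (F.bond h a) = G.bond h (φ.app (op y) a) :=
  congrArg (fun t => t.hom a) (φ.naturality (homOfLE h).op)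

section Cochains

variable {P : Type w} [SemilatticeInf P]

theorem bond_cochain_congr {F : InvSystem.{u} P} {n : ℕ} (y : Cochain F n) {p : P}
    {x x' : Fin (n + 1) → P} (e : x = x') (h : p ≤ meet x) (h' : p ≤ meet x') :
    F.bond h (y x) = F.bond h' (y x') := by
  subst e; rfl

theorem le_meet {n : ℕ} {p : P} {x : Fin (n + 1) → P} (h : ∀ i, p ≤ x i) : p ≤ meet x :=
  Finset.le_inf' _ _ fun i _ => h i

/-- The restriction of a cochain to the tuples of elements above `p`, with all values mapped to
the group at `p`. -/
def Cochain.localize {F : InvSystem.{u} P} {n : ℕ} (y : Cochain F n) (p : P)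
    (x : Fin (n + 1) → Set.Ici p) : F.obj (op p) :=
  F.bond (le_meet fun i => (x i).2) (y fun i => (x i).1)

/-- A tuple regarded as a tuple of elements above its meet. -/
def aboveMeet {n : ℕ} (x : Fin (n + 1) → P) (i : Fin (n + 1)) : Set.Ici (meet x) :=
  ⟨x i, Finset.inf'_le x (Finset.mem_univ i)⟩

theorem aboveMeet_injective_iff {n : ℕ} (x : Fin (n + 1) → P) :
    Function.Injective (aboveMeet x) ↔ Function.Injective x :=
  ⟨fun h _ _ hij => h (Subtype.ext hij), fun h _ _ hij => h (congrArg Subtype.val hij)⟩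

theorem Cochain.localize_aboveMeet {F : InvSystem.{u} P} {n : ℕ} (y : Cochain F n)
    (x : Fin (n + 1) → P) : y.localize (meet x) (aboveMeet x) = y x :=
  F.bond_self _ _

theorem Cochain.localize_coboundary {F : InvSystem.{u} P} {n : ℕ} (y : Cochain F n) (p : P) :
    Cochain.localize (coboundary F y) p = constCoboundary (y.localize p) := by
  funext x
  simp only [Cochain.localize, coboundary, constCoboundary, map_sum, map_zsmul,
    InvSystem.bond_bond]
  rfl

theorem coboundary_apply {F : InvSystem.{u} P} {n : ℕ} (y : Cochain F n) (x : Fin (n + 2) → P) :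
    coboundary F y x = constCoboundary (y.localize (meet x)) (aboveMeet x) := by
  rw [← Cochain.localize_coboundary, Cochain.localize_aboveMeet]

theorem mem_altCochains_iff {F : InvSystem.{u} P} {n : ℕ} (y : Cochain F n) :
    y ∈ altCochains F n ↔ ∀ p, IsAlternating (y.localize p) := by
  constructor
  · intro hy p σ x
    have := hy σ (fun i => (x i).1)
    simp only [Cochain.localize]
    rw [this, map_zsmul, InvSystem.bond_bond]
    rfl
  · intro hy σ x
    have := hy (meet x) σ (aboveMeet x)
    rw [Cochain.localize_aboveMeet] at this
    exact this

theorem coboundary_mem_altCochains {F : InvSystem.{u} P} {n : ℕ} {y : Cochain F n}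
    (hy : y ∈ altCochains F n) : coboundary F y ∈ altCochains F (n + 1) := by
  rw [mem_altCochains_iff] at hy ⊢
  intro p
  rw [Cochain.localize_coboundary]
  exact (hy p).constCoboundary

theorem coboundary_coboundary {F : InvSystem.{u} P} {n : ℕ} (y : Cochain F n) :
    coboundary F (coboundary F y) = 0 := by
  funext x
  rw [coboundary_apply, Cochain.localize_coboundary]
  exact constCoboundary_constCoboundary _ _

/-- The strictly alternating cochains: those which in addition vanish on tuples with repeated
entries. In contrast to `altCochains`, these depend exactly on the inverse system. -/
def strictCochains (F : InvSystem.{u} P) (n : ℕ) : AddSubgroup (Cochain F n) where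
  carrier := {y | y ∈ altCochains F n ∧ ∀ x, ¬ Function.Injective x → y x = 0}
  zero_mem' := ⟨zero_mem _, fun _ _ => rfl⟩
  add_mem' := by
    intro a b ha hb
    refine ⟨add_mem ha.1 hb.1, fun x hx => ?_⟩
    rw [Pi.add_apply, ha.2 x hx, hb.2 x hx, add_zero]
  neg_mem' := by
    intro a ha
    refine ⟨neg_mem ha.1, fun x hx => ?_⟩
    rw [Pi.neg_apply, ha.2 x hx, neg_zero]

theorem coboundary_add {F : InvSystem.{u} P} {n : ℕ} (y z : Cochain F n) :
    coboundary F (y + z) = coboundary F y + coboundary F z := by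
  funext x
  simp [coboundary, Finset.sum_add_distrib]

theorem coboundary_mem_strictCochains {F : InvSystem.{u} P} {n : ℕ} {y : Cochain F n}
    (hy : y ∈ strictCochains F n) : coboundary F y ∈ strictCochains F (n + 1) := by
  refine ⟨coboundary_mem_altCochains hy.1, fun x hx => ?_⟩
  rw [coboundary_apply]
  refine constCoboundary_eq_zero_of_not_injective ((mem_altCochains_iff y).1 hy.1 _)
    (fun z hz => ?_) _ (fun h => hx ((aboveMeet_injective_iff x).1 h))
  have h0 : y (fun i => (z i).1) = 0 := hy.2 _ fun h => hz fun i j hij =>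
    h (congrArg Subtype.val hij)
  simp only [Cochain.localize, h0, map_zero]

/-- The coboundary on strictly alternating cochains. -/
def strictD (F : InvSystem.{u} P) (n : ℕ) : strictCochains F n →+ strictCochains F (n + 1) :=
  AddMonoidHom.mk' (fun y => ⟨coboundary F y.1, coboundary_mem_strictCochains y.2⟩)
    fun y z => Subtype.ext (coboundary_add y.1 z.1)

theorem strictD_strictD (F : InvSystem.{u} P) (n : ℕ) (y : strictCochains F n) :
    strictD F (n + 1) (strictD F n y) = 0 :=
  Subtype.ext (coboundary_coboundary y.1)

/-- A morphism of inverse systems maps alternating cochains to alternating cochains. -/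
theorem map_mem_altCochains {F G : InvSystem.{u} P} (φ : F ⟶ G) {n : ℕ} {y : Cochain F n}
    (hy : y ∈ altCochains F n) : (fun x => φ.app (op (meet x)) (y x)) ∈ altCochains G n := by
  intro σ x
  dsimp only
  rw [hy σ x, map_zsmul, InvSystem.app_bond]

theorem map_coboundary {F G : InvSystem.{u} P} (φ : F ⟶ G) {n : ℕ} (y : Cochain F n)
    (x : Fin (n + 2) → P) : φ.app (op (meet x)) (coboundary F y x) =
      coboundary G (fun x => φ.app (op (meet x)) (y x)) x := by
  simp only [coboundary, map_sum, map_zsmul, InvSystem.app_bond]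

/-- The map on strictly alternating cochains induced by a morphism of inverse systems. -/
def strictMap {F G : InvSystem.{u} P} (φ : F ⟶ G) (n : ℕ) :
    strictCochains F n →+ strictCochains G n :=
  AddMonoidHom.mk' (fun y => ⟨fun x => φ.app (op (meet x)) (y.1 x), map_mem_altCochains φ y.2.1,
    fun x hx => by dsimp only; rw [y.2.2 x hx, map_zero]⟩)
    fun y z => Subtype.ext (funext fun x => map_add _ _ _)

theorem strictMap_apply {F G : InvSystem.{u} P} (φ : F ⟶ G) {n : ℕ} (y : strictCochains F n)
    (x : Fin (n + 1) → P) : (strictMap φ n y).1 x = φ.app (op (meet x)) (y.1 x) := rfl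

theorem strictMap_strictD {F G : InvSystem.{u} P} (φ : F ⟶ G) {n : ℕ} (y : strictCochains F n) :
    strictMap φ (n + 1) (strictD F n y) = strictD G n (strictMap φ n y) :=
  Subtype.ext (funext fun x => map_coboundary φ y.1 x)

theorem strictMap_comp {F G H : InvSystem.{u} P} (φ : F ⟶ G) (ψ : G ⟶ H) {n : ℕ}
    (y : strictCochains F n) : strictMap (φ ≫ ψ) n y = strictMap ψ n (strictMap φ n y) := rfl

theorem strictMap_id {F : InvSystem.{u} P} {n : ℕ} (y : strictCochains F n) :
    strictMap (𝟙 F) n y = y := rfl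

theorem strictMap_zero {F G : InvSystem.{u} P} {n : ℕ} (y : strictCochains F n) :
    strictMap (0 : F ⟶ G) n y = 0 := rfl

open Classical in
/-- Replacing the values of an alternating cochain `w` at tuples with repeated entries by `0`
gives a strictly alternating cochain with the same coboundary, if `d w` is strictly alternating:
the faces of a tuple without repetitions have no repetitions. -/
theorem exists_strictCochain_of_altCochain {F : InvSystem.{u} P} {n : ℕ} {w : Cochain F n}
    (hw : w ∈ altCochains F n) (y : strictCochains F (n + 1)) (hy : coboundary F w = y.1) :
    ∃ z : strictCochains F n, strictD F n z = y := by
  let z : Cochain F n := fun x => if Function.Injective x then w x else 0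
  have hz : z ∈ strictCochains F n := by
    constructor
    · intro σ x
      by_cases hx : Function.Injective x
      · have hx' : Function.Injective (x ∘ σ) := hx.comp σ.injective
        simp only [z, if_pos hx, if_pos hx']
        exact hw σ x
      · have hx' : ¬ Function.Injective (x ∘ σ) := fun h => hx (by
          simpa [Function.comp_assoc] using h.comp σ.symm.injective)
        simp only [z, if_neg hx, if_neg hx', map_zero, smul_zero]
    · intro x hx
      exact if_neg hx
  refine ⟨⟨z, hz⟩, Subtype.ext (funext fun x => ?_)⟩
  by_cases hx : Function.Injective x
  · rw [← hy]
    change coboundary F z x = coboundary F w x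
    refine Finset.sum_congr rfl fun i _ => ?_
    have hxi : Function.Injective (x ∘ i.succAbove) := hx.comp Fin.succAbove_right_injective
    simp only [z, if_pos hxi]
  · rw [(strictD F n ⟨z, hz⟩).2.2 x hx, y.2.2 x hx]

/-- Tuples which differ by a permutation of their entries. -/
def permSetoid (P : Type w) (n : ℕ) : Setoid (Fin n → P) where
  r x y := ∃ σ : Equiv.Perm (Fin n), y = x ∘ σ
  iseqv :=
    { refl := fun x => ⟨1, rfl⟩
      symm := by
        rintro x y ⟨σ, rfl⟩
        exact ⟨σ⁻¹, by funext i; simp⟩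
      trans := by
        rintro x y z ⟨σ, rfl⟩ ⟨τ, rfl⟩
        exact ⟨σ * τ, by funext i; simp⟩ }

open Classical in
/-- The functors `F ↦ strictCochains F n` are exact: lift the value at one representative of each
class of injective tuples up to permutation, and extend by alternation. -/
theorem exists_strictMap_eq {F G H : InvSystem.{u} P} (φ : F ⟶ G) (ψ : G ⟶ H)
    (hex : ∀ (p : P) (b : G.obj (op p)), ψ.app (op p) b = 0 → ∃ a, φ.app (op p) a = b)
    {n : ℕ} (y : strictCochains G n) (hy : strictMap ψ n y = 0) :
    ∃ z : strictCochains F n, strictMap φ n z = y := by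
  have hlift : ∀ x : Fin (n + 1) → P, ∃ a, φ.app (op (meet x)) a = y.1 x := fun x =>
    hex _ _ (congrFun (congrArg Subtype.val hy) x)
  choose w hw using hlift
  let rep : (Fin (n + 1) → P) → (Fin (n + 1) → P) := fun x =>
    (Quotient.mk (permSetoid P (n + 1)) x).out
  have hrep : ∀ x, ∃ σ : Equiv.Perm (Fin (n + 1)), rep x = x ∘ σ := fun x =>
    (permSetoid P (n + 1)).symm (Quotient.mk_out (s := permSetoid P (n + 1)) x)
  choose s hs using hrep
  have hrep' : ∀ x (σ : Equiv.Perm (Fin (n + 1))), rep (x ∘ σ) = rep x := fun x σ =>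
    congrArg Quotient.out (Quotient.sound (s := permSetoid P (n + 1))
      ((permSetoid P (n + 1)).symm ⟨σ, rfl⟩))
  have hle : ∀ x, meet x ≤ meet (rep x) := fun x => by
    rw [hs x]; exact meet_le_meet_comp x _
  let z : Cochain F n := fun x => if Function.Injective x then
    (Equiv.Perm.sign (s x) : ℤ) • F.bond (hle x) (w (rep x)) else 0
  have hz : z ∈ strictCochains F n := by
    constructor
    · intro σ x
      by_cases hx : Function.Injective x
      · have hx' : Function.Injective (x ∘ σ) := hx.comp σ.injective
        have hσ : s x = σ * s (x ∘ σ) := by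
          refine Equiv.ext fun i => hx ?_
          have h1 := congrFun (hs x) i
          have h2 := congrFun (hs (x ∘ σ)) i
          rw [hrep' x σ, h1] at h2
          exact h2
        simp only [z, if_pos hx, if_pos hx', map_zsmul, InvSystem.bond_bond, smul_smul]
        rw [bond_cochain_congr w (hrep' x σ) _ (hle x)]
        congr 1
        have h3 : Equiv.Perm.sign (s x) = Equiv.Perm.sign σ * Equiv.Perm.sign (s (x ∘ σ)) := by
          rw [← Equiv.Perm.sign_mul, ← hσ]
        rw [h3, Units.val_mul]
      · have hx' : ¬ Function.Injective (x ∘ σ) := fun h => hx (by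
          simpa [Function.comp_assoc] using h.comp σ.symm.injective)
        simp only [z, if_neg hx, if_neg hx', map_zero, smul_zero]
    · intro x hx
      exact if_neg hx
  refine ⟨⟨z, hz⟩, Subtype.ext (funext fun x => ?_)⟩
  rw [strictMap_apply]
  by_cases hx : Function.Injective x
  · simp only [z, if_pos hx, map_zsmul, InvSystem.app_bond, hw]
    rw [y.2.1 (s x) x, bond_cochain_congr y.1 (hs x) _ (meet_le_meet_comp x (s x))]
  · simp only [z, if_neg hx, map_zero, y.2.2 x hx]

/-! ### Cochain-acyclic inverse systems -/

/-- The complex of strictly alternating cochains of `F` has no cohomology in positive degrees. -/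
def IsCochainAcyclic (F : InvSystem.{u} P) : Prop :=
  ∀ (n : ℕ) (y : strictCochains F (n + 1)), strictD F (n + 1) y = 0 →
    ∃ z : strictCochains F n, strictD F n z = y

theorem IsCochainAcyclic.of_retract {F E : InvSystem.{u} P} (i : F ⟶ E) (r : E ⟶ F)
    (hir : i ≫ r = 𝟙 F) (hE : IsCochainAcyclic E) : IsCochainAcyclic F := by
  intro n y hy
  obtain ⟨z, hz⟩ := hE n (strictMap i _ y) (by rw [← strictMap_strictD, hy, map_zero])
  exact ⟨strictMap r n z, by
    rw [← strictMap_strictD, hz, ← strictMap_comp, hir, strictMap_id]⟩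

end Cochains

section Godement

variable {P : Type u} [SemilatticeInf P]

/-- The inverse system `x ↦ ∏_{q ≤ x} F_q`, with the projections as bonding maps. -/
def godement (F : InvSystem.{u} P) : InvSystem.{u} P where
  obj x := AddCommGrpCat.of (∀ q : {q : P // q ≤ x.unop}, F.obj (op q.1))
  map f := AddCommGrpCat.ofHom
    (AddMonoidHom.mk' (fun a q => a ⟨q.1, q.2.trans (leOfHom f.unop)⟩) fun _ _ => rfl)
  map_id _ := rfl
  map_comp _ _ := rfl

/-- The embedding `F_x → ∏_{q ≤ x} F_q` given by the bonding maps. -/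
def toGodement (F : InvSystem.{u} P) : F ⟶ godement F where
  app x := AddCommGrpCat.ofHom
    (AddMonoidHom.mk' (fun a q => F.bond q.2 a) fun _ _ => funext fun _ => map_add _ _ _)
  naturality x y f := by
    ext a
    funext q
    exact F.bond_bond _ _ a

theorem toGodement_app_injective (F : InvSystem.{u} P) (x : Pᵒᵖ) :
    Function.Injective ((toGodement F).app x) := by
  intro a b hab
  have h : F.bond le_rfl a = F.bond le_rfl b := congrFun hab ⟨x.unop, le_rfl⟩
  rwa [InvSystem.bond_self, InvSystem.bond_self] at h

/-- The component at `q` of a cochain of the system `∏_{q ≤ x} F_q`: a cochain on the elements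
above `q` with constant coefficients `F_q`. -/
def godementComponent {F : InvSystem.{u} P} {n : ℕ} (y : Cochain (godement F) n) (q : P)
    (x : Fin (n + 1) → Set.Ici q) : F.obj (op q) :=
  y (fun i => (x i).1) ⟨q, le_meet fun i => (x i).2⟩

theorem godementComponent_coboundary {F : InvSystem.{u} P} {n : ℕ} (y : Cochain (godement F) n)
    (q : P) : godementComponent (coboundary (godement F) y) q =
      constCoboundary (godementComponent y q) := by
  funext x
  simp only [godementComponent, coboundary, constCoboundary]
  let ev : (godement F).obj (op (meet fun i => (x i).1)) →+ F.obj (op q) :=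
    Pi.evalAddMonoidHom (fun r : {r : P // r ≤ meet fun i => (x i).1} => F.obj (op r.1))
      ⟨q, le_meet fun i => (x i).2⟩
  refine (map_sum ev (fun i : Fin (n + 2) => ((-1) ^ (i : ℕ) : ℤ) • (godement F).bond
    (meet_le_meet_comp (fun i => (x i).1) i.succAbove) (y ((fun i => (x i).1) ∘ i.succAbove)))
    Finset.univ).trans (Finset.sum_congr rfl fun i _ => ?_)
  rw [map_zsmul]
  rfl

/-- The component at `q` of the coboundary is contracted by coning off at the vertex `q`. -/
theorem isCochainAcyclic_godement (F : InvSystem.{u} P) : IsCochainAcyclic (godement F) := by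
  intro n y hy
  let v : ∀ q : P, Set.Ici q := fun q => ⟨q, le_rfl⟩
  let lift : ∀ (x : Fin (n + 1) → P) (q : {q : P // q ≤ meet x}), Fin (n + 1) → Set.Ici q.1 :=
    fun x q i => ⟨x i, q.2.trans (Finset.inf'_le x (Finset.mem_univ i))⟩
  let z : Cochain (godement F) n := fun x q =>
    godementComponent y.1 q.1 (Fin.cons (v q.1) (lift x q))
  have halt : ∀ q : P, IsAlternating (godementComponent y.1 q) := by
    intro q σ x
    have h := congrFun (y.2.1 σ fun i => (x i).1) ⟨q, le_meet fun i => (x i).2⟩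
    refine h.trans ?_
    rfl
  have hz : z ∈ strictCochains (godement F) n := by
    constructor
    · intro σ x
      funext q
      refine ((halt q.1).cons (v q.1) σ (lift x q)).trans ?_
      rfl
    · intro x hx
      funext q
      refine congrFun (y.2.2 _ fun h => hx fun i j hij => ?_) _
      have h1 := @h i.succ j.succ (by simp [lift, hij])
      exact Fin.succ_injective _ h1
  refine ⟨⟨z, hz⟩, Subtype.ext (funext fun x => funext fun q => ?_)⟩
  let x' : Fin (n + 2) → Set.Ici q.1 := fun i =>
    ⟨x i, q.2.trans (Finset.inf'_le x (Finset.mem_univ i))⟩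
  have h1 : godementComponent (coboundary (godement F) y.1) q.1 (Fin.cons (v q.1) x') = 0 :=
    congrFun (congrFun (congrArg Subtype.val hy) fun i =>
      ((Fin.cons (v q.1) x' : Fin (n + 3) → Set.Ici q.1) i).1) _
  rw [godementComponent_coboundary, constCoboundary_cons, sub_eq_zero] at h1
  refine Eq.trans ?_ h1.symm
  exact congrFun (godementComponent_coboundary z q.1) x'

/-- An injective inverse system is a direct summand of `x ↦ ∏_{q ≤ x} F_q`. -/
theorem isCochainAcyclic_of_injective (F : InvSystem.{u} P) [Injective F] :
    IsCochainAcyclic F := by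
  have : ∀ x, Mono ((toGodement F).app x) := fun x =>
    (AddCommGrpCat.mono_iff_injective _).2 (toGodement_app_injective F x)
  have : Mono (toGodement F) := NatTrans.mono_of_mono_app _
  exact IsCochainAcyclic.of_retract (toGodement F) (Injective.factorThru (𝟙 F) (toGodement F))
    (Injective.comp_factorThru _ _) (isCochainAcyclic_godement F)

end Godement

/-! ### Acyclicity of the systems `Ḡ` and `G` for injective `𝒢` -/

section Acyclicity

variable {κ : Type u}

/-- The projection of `Ḡ` to its factor at `α`. -/
def prodProjection (𝒢 : OmegaSystem κ) (α : κ) :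
    prodSystem 𝒢 ⟶ (pullback (evalAt α)).obj (𝒢 α) where
  app x := AddCommGrpCat.ofHom
    (Pi.evalAddMonoidHom (fun β => (𝒢 β).obj (op (x.unop β))) α)
  naturality _ _ _ := rfl

/-- Reindexing along an evaluation preserves injectives, so every factor of `Ḡ` is acyclic. -/
theorem isCochainAcyclic_prodSystem (𝒢 : OmegaSystem κ) (h𝒢 : ∀ α, Injective (𝒢 α)) :
    IsCochainAcyclic (prodSystem 𝒢) := by
  intro n y hy
  have hα : ∀ α, ∃ z, strictD ((pullback (evalAt α)).obj (𝒢 α)) n z =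
      strictMap (prodProjection 𝒢 α) _ y := fun α => by
    have : Injective ((pullback (evalAt α)).obj (𝒢 α)) :=
      Injective.injective_of_adjoint
        (pullbackAdjunction (evalAt α) (singleAt α) (singleAt_gc α)) (𝒢 α)
    exact isCochainAcyclic_of_injective _ n _ (by rw [← strictMap_strictD, hy, map_zero])
  choose z hz using hα
  let Z : Cochain (prodSystem 𝒢) n := fun x α => (z α).1 x
  have hZ : Z ∈ strictCochains (prodSystem 𝒢) n :=
    ⟨fun σ x => funext fun α => (z α).2.1 σ x, fun x hx => funext fun α => (z α).2.2 x hx⟩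
  refine ⟨⟨Z, hZ⟩, Subtype.ext (funext fun x => funext fun α => ?_)⟩
  refine Eq.trans ?_ (congrFun (congrArg Subtype.val (hz α)) x)
  exact map_coboundary (prodProjection 𝒢 α) Z x

theorem isInjective_of_injective (𝒢 : OmegaSystem κ) (h𝒢 : ∀ α, Injective (𝒢 α)) :
    𝒢.IsInjective := by
  intro ℱ ℋ φ ψ hψ
  have hmono : ∀ α, Mono (ψ α) := fun α => by
    have : ∀ k, Mono ((ψ α).app k) := fun k =>
      (AddCommGrpCat.mono_iff_injective _).2 (hψ α k.unop)
    exact NatTrans.mono_of_mono_app _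
  exact ⟨fun α => Injective.factorThru (φ α) (ψ α), fun α => Injective.comp_factorThru _ _⟩

theorem sumToProd_app_injective (𝒢 : OmegaSystem κ) (x : (κ → ℕ)ᵒᵖ) :
    Function.Injective ((sumToProd 𝒢).app x) := Subtype.val_injective

theorem coboundary_sub {P : Type w} [SemilatticeInf P] {F : InvSystem.{u} P} {n : ℕ}
    (y z : Cochain F n) : coboundary F (y - z) = coboundary F y - coboundary F z := by
  funext x
  simp [coboundary, smul_sub]

/-- If `Φ` has values in `Ḡ` and its coboundary is the cocycle `y` with values in `G`, then
triviality of `Φ` allows one to change `Φ` by a cocycle such that the values are in `G`. -/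
theorem exists_altCochain_of_isTrivial (𝒢 : OmegaSystem κ) {m : ℕ}
    (Φ : Cochain (prodSystem 𝒢) m) (hΦ : Φ ∈ altCochains (prodSystem 𝒢) m)
    (y : Cochain (sumSystem 𝒢) (m + 1))
    (hy : ∀ x, coboundary (prodSystem 𝒢) Φ x = (sumToProd 𝒢).app (op (meet x)) (y x))
    (ht : IsTrivial 𝒢 m Φ) :
    ∃ w ∈ altCochains (sumSystem 𝒢) m, coboundary (sumSystem 𝒢) w = y := by
  obtain ⟨Θ, hΘ, hdΘ, hfin⟩ : ∃ Θ ∈ altCochains (prodSystem 𝒢) m,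
      coboundary (prodSystem 𝒢) Θ = 0 ∧ ∀ x, EqMod 𝒢 (Φ x) (Θ x) := by
    cases m with
    | zero =>
      obtain ⟨ψ, hψ, hfin⟩ := ht
      refine ⟨fun x => ψ (meet x), ?_, ?_, hfin⟩
      · intro σ x
        obtain rfl : σ = 1 := Subsingleton.elim (α := Equiv.Perm (Fin 1)) σ 1
        rw [hψ]
        simp
      · funext x
        simp [coboundary, hψ, Fin.sum_univ_succ]
    | succ m =>
      obtain ⟨Ψ, hΨ, hfin⟩ := ht
      exact ⟨coboundary _ Ψ, coboundary_mem_altCochains hΨ, coboundary_coboundary Ψ, hfin⟩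
  have hmem : ∀ x : Fin (m + 1) → κ → ℕ, (Φ - Θ) x ∈ finSupp fun α => (𝒢 α).obj (op (meet x α)) := fun x =>
    Set.Finite.subset (hfin x) fun α hα h => hα (sub_eq_zero.2 h)
  have hsub := sub_mem hΦ hΘ
  let w : Cochain (sumSystem 𝒢) m := fun x => ⟨(Φ - Θ) x, hmem x⟩
  refine ⟨w, fun σ x => ?_, funext fun x => ?_⟩
  · refine sumToProd_app_injective 𝒢 _ ?_
    rw [map_zsmul, InvSystem.app_bond]
    exact hsub σ x
  · refine sumToProd_app_injective 𝒢 _ ?_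
    rw [map_coboundary, ← hy]
    change coboundary (prodSystem 𝒢) (Φ - Θ) x = _
    rw [coboundary_sub, hdΘ, sub_zero]

/-- Triviality of all coherent families for `𝒢` gives the acyclicity of `G`: a cocycle with values
in `G` is the coboundary of some `Φ` with values in the acyclic system `Ḡ`, and `Φ` is coherent. -/
theorem isCochainAcyclic_sumSystem (𝒢 : OmegaSystem κ) (h𝒢 : ∀ α, Injective (𝒢 α))
    (h : ∀ (m : ℕ) (Φ : Cochain (prodSystem 𝒢) m), IsCoherent 𝒢 m Φ → IsTrivial 𝒢 m Φ) :
    IsCochainAcyclic (sumSystem 𝒢) := by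
  intro m y hy
  obtain ⟨Φ, hΦ⟩ := isCochainAcyclic_prodSystem 𝒢 h𝒢 m (strictMap (sumToProd 𝒢) _ y)
    (by rw [← strictMap_strictD, hy, map_zero])
  have hΦy : ∀ x, coboundary (prodSystem 𝒢) Φ.1 x = (sumToProd 𝒢).app (op (meet x)) (y.1 x) :=
    fun x => congrFun (congrArg Subtype.val hΦ) x
  obtain ⟨w, hw, hwy⟩ := exists_altCochain_of_isTrivial 𝒢 Φ.1 Φ.2.1 y.1 hΦy
    (h m Φ.1 ⟨Φ.2.1, y.1, y.2.1, hΦy⟩)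
  exact exists_strictCochain_of_altCochain hw y hwy

end Acyclicity

/-! ### A comparison lemma for double complexes -/

section DoubleComplex

/-- A morphism `f : A → B` of double complexes in the first quadrant such that the columns (the
differential `δ`) are exact in positive degrees, and the mapping cones of the maps between rows
(the differential `d`) are exact. A cocycle of the cone in degree `n` is a pair `(a, b)` with
`d a = 0` and `f a = d b`; it is the boundary of `(a', b')` if `a = d a'` and
`b = f a' - d b'`. -/
structure RowwiseQuasiIso (A B : ℕ → ℕ → Type u) [∀ k n, AddCommGroup (A k n)]
    [∀ k n, AddCommGroup (B k n)] where
  /-- The differential of the rows of `A`. -/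
  dA : ∀ k n, A k n →+ A k (n + 1)
  /-- The differential of the rows of `B`. -/
  dB : ∀ k n, B k n →+ B k (n + 1)
  /-- The differential of the columns of `A`. -/
  δA : ∀ k n, A k n →+ A (k + 1) n
  /-- The differential of the columns of `B`. -/
  δB : ∀ k n, B k n →+ B (k + 1) n
  /-- The morphism of double complexes. -/
  f : ∀ k n, A k n →+ B k n
  dA_dA : ∀ k n a, dA k (n + 1) (dA k n a) = 0
  dB_dB : ∀ k n b, dB k (n + 1) (dB k n b) = 0
  δA_δA : ∀ k n a, δA (k + 1) n (δA k n a) = 0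
  δB_δB : ∀ k n b, δB (k + 1) n (δB k n b) = 0
  dA_δA : ∀ k n a, dA (k + 1) n (δA k n a) = δA k (n + 1) (dA k n a)
  dB_δB : ∀ k n b, dB (k + 1) n (δB k n b) = δB k (n + 1) (dB k n b)
  f_dA : ∀ k n a, f k (n + 1) (dA k n a) = dB k n (f k n a)
  f_δA : ∀ k n a, f (k + 1) n (δA k n a) = δB k n (f k n a)
  exactA : ∀ k n (a : A (k + 1) n), δA (k + 1) n a = 0 → ∃ a', δA k n a' = a
  exactB : ∀ k n (b : B (k + 1) n), δB (k + 1) n b = 0 → ∃ b', δB k n b' = b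
  cone_mono : ∀ k (a : A k 0), dA k 0 a = 0 → f k 0 a = 0 → a = 0
  cone_exact_zero : ∀ k (a : A k 1) (b : B k 0), dA k 1 a = 0 → f k 1 a = dB k 0 b →
    ∃ a', dA k 0 a' = a ∧ f k 0 a' = b
  cone_exact_succ : ∀ k n (a : A k (n + 2)) (b : B k (n + 1)), dA k (n + 2) a = 0 →
    f k (n + 2) a = dB k (n + 1) b → ∃ a' b', dA k (n + 1) a' = a ∧ f k (n + 1) a' - dB k n b' = b

variable {A B : ℕ → ℕ → Type u} [∀ k n, AddCommGroup (A k n)] [∀ k n, AddCommGroup (B k n)]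
  (D : RowwiseQuasiIso A B)

namespace RowwiseQuasiIso

theorem exists_closed_zero (k : ℕ) (a : A k 1) (b : B k 0) (ha : D.dA k 1 a = 0)
    (hab : D.f k 1 a = D.dB k 0 b) (hδa : D.δA k 1 a = 0) (hδb : D.δB k 0 b = 0) :
    ∃ a', D.δA k 0 a' = 0 ∧ D.dA k 0 a' = a ∧ D.f k 0 a' = b := by
  obtain ⟨a', h1, h2⟩ := D.cone_exact_zero k a b ha hab
  refine ⟨a', D.cone_mono _ _ ?_ ?_, h1, h2⟩
  · rw [D.dA_δA, h1, hδa]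
  · rw [D.f_δA, h2, hδb]

/-- A cocycle of the cone which is closed for the column differential is the boundary of a pair
which is also closed. If `(a', b')` is any preimage, then `(δ a', δ b')` is a closed cocycle of
lower degree in the next row; by induction it is the boundary of a closed pair, which is `δ` of
some `(u, v)`, and the boundary of `(u, v)` corrects `(a', b')`. -/
theorem exists_closed_succ (n : ℕ) : ∀ (k : ℕ) (a : A k (n + 2)) (b : B k (n + 1)),
    D.dA k (n + 2) a = 0 → D.f k (n + 2) a = D.dB k (n + 1) b → D.δA k (n + 2) a = 0 →
    D.δB k (n + 1) b = 0 → ∃ a' b', D.δA k (n + 1) a' = 0 ∧ D.δB k n b' = 0 ∧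
      D.dA k (n + 1) a' = a ∧ D.f k (n + 1) a' - D.dB k n b' = b := by
  induction n with
  | zero =>
    intro k a b ha hab hδa hδb
    obtain ⟨a', b', h1, h2⟩ := D.cone_exact_succ k 0 a b ha hab
    obtain ⟨a'', hδ, e1, e2⟩ := D.exists_closed_zero (k + 1) (D.δA k 1 a') (D.δB k 0 b')
      (by rw [D.dA_δA, h1, hδa])
      (by rw [D.f_δA, D.dB_δB, ← sub_eq_zero, ← map_sub, h2, hδb])
      (D.δA_δA _ _ _) (D.δB_δB _ _ _)
    obtain ⟨u, rfl⟩ := D.exactA k 0 a'' hδ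
    refine ⟨a' - D.dA k 0 u, b' - D.f k 0 u, ?_, ?_, ?_, ?_⟩
    · rw [map_sub, ← D.dA_δA, e1, sub_self]
    · rw [map_sub, ← D.f_δA, e2, sub_self]
    · rw [map_sub, h1, D.dA_dA, sub_zero]
    · rw [map_sub, map_sub, D.f_dA, sub_sub_sub_cancel_right, h2]
  | succ n ih =>
    intro k a b ha hab hδa hδb
    obtain ⟨a', b', h1, h2⟩ := D.cone_exact_succ k (n + 1) a b ha hab
    obtain ⟨a'', b'', hδa', hδb', e1, e2⟩ := ih (k + 1) (D.δA k (n + 2) a') (D.δB k (n + 1) b')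
      (by rw [D.dA_δA, h1, hδa])
      (by rw [D.f_δA, D.dB_δB, ← sub_eq_zero, ← map_sub, h2, hδb])
      (D.δA_δA _ _ _) (D.δB_δB _ _ _)
    obtain ⟨u, rfl⟩ := D.exactA k (n + 1) a'' hδa'
    obtain ⟨v, rfl⟩ := D.exactB k n b'' hδb'
    refine ⟨a' - D.dA k (n + 1) u, b' - (D.f k (n + 1) u - D.dB k n v), ?_, ?_, ?_, ?_⟩
    · rw [map_sub, ← D.dA_δA, e1, sub_self]
    · rw [map_sub, map_sub, ← D.f_δA, ← D.dB_δB, e2, sub_self]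
    · rw [map_sub, h1, D.dA_dA, sub_zero]
    · rw [map_sub, map_sub, map_sub, D.f_dA, D.dB_dB, sub_zero, sub_sub_sub_cancel_right, h2]

end RowwiseQuasiIso

end DoubleComplex

/-! ### Elements of inverse limits -/

section Lim

variable {P : Type w} [Preorder P] [HasLimitsOfShape Pᵒᵖ AddCommGrpCat.{u}]

/-- The projection of `lim F` to `F_p`. -/
def limProj (F : InvSystem.{u} P) (p : P) :
    ((lim : InvSystem.{u} P ⥤ AddCommGrpCat.{u}).obj F) →+ F.obj (op p) :=
  (limit.π F (op p)).hom

theorem bond_limProj (F : InvSystem.{u} P) {p q : P} (h : p ≤ q)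
    (s : (lim : InvSystem.{u} P ⥤ AddCommGrpCat.{u}).obj F) :
    F.bond h (limProj F q s) = limProj F p s :=
  congrArg (fun t => t.hom s) (limit.w F (homOfLE h).op)

theorem limProj_map {F G : InvSystem.{u} P} (φ : F ⟶ G) (p : P)
    (s : (lim : InvSystem.{u} P ⥤ AddCommGrpCat.{u}).obj F) :
    limProj G p ((lim : InvSystem.{u} P ⥤ AddCommGrpCat.{u}).map φ s) =
      φ.app (op p) (limProj F p s) :=
  congrArg (fun t => t.hom s) (limMap_π φ (op p))

/-- The homomorphism from (a lift of) `ℤ` that takes `1` to `a`. It turns elements into morphisms,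
to which the universal property of the limit applies. -/
def homOfElement {A : AddCommGrpCat.{u}} (a : A) : AddCommGrpCat.of (ULift.{u} ℤ) ⟶ A :=
  AddCommGrpCat.ofHom ((zmultiplesHom A a).comp AddEquiv.ulift.toAddMonoidHom)

theorem homOfElement_apply {A : AddCommGrpCat.{u}} (a : A) : homOfElement a ⟨1⟩ = a :=
  one_zsmul a

theorem hom_ext_of_int {A : AddCommGrpCat.{u}} {f g : AddCommGrpCat.of (ULift.{u} ℤ) ⟶ A}
    (h : f ⟨1⟩ = g ⟨1⟩) : f = g := by
  refine AddCommGrpCat.hom_ext (AddMonoidHom.ext fun n => ?_)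
  have hn : n = n.down • (⟨1⟩ : ULift.{u} ℤ) := by
    apply ULift.ext; simp
  rw [hn]
  exact (map_zsmul f.hom _ _).trans ((congrArg _ h).trans (map_zsmul g.hom _ _).symm)

theorem lim_ext {F : InvSystem.{u} P} {s t : (lim : InvSystem.{u} P ⥤ AddCommGrpCat.{u}).obj F}
    (h : ∀ p, limProj F p s = limProj F p t) : s = t := by
  have : homOfElement s = homOfElement t := limit.hom_ext fun p => hom_ext_of_int (by
    change limProj F p.unop (homOfElement s ⟨1⟩) = limProj F p.unop (homOfElement t ⟨1⟩)
    rw [homOfElement_apply, homOfElement_apply, h])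
  rw [← homOfElement_apply s, this, homOfElement_apply]

theorem exists_lim_of_compatible {F : InvSystem.{u} P} (a : ∀ p, F.obj (op p))
    (ha : ∀ p q (h : p ≤ q), F.bond h (a q) = a p) :
    ∃ s : (lim : InvSystem.{u} P ⥤ AddCommGrpCat.{u}).obj F, ∀ p, limProj F p s = a p := by
  let c : Cone F :=
    { pt := AddCommGrpCat.of (ULift.{u} ℤ)
      π :=
        { app := fun p => homOfElement (a p.unop)
          naturality := fun p q f => hom_ext_of_int (by
            change homOfElement (a q.unop) ⟨1⟩ =
              F.bond (leOfHom f.unop) (homOfElement (a p.unop) ⟨1⟩)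
            rw [homOfElement_apply, homOfElement_apply, ha]) } }
  refine ⟨limit.lift F c ⟨1⟩, fun p => ?_⟩
  refine (congrArg (fun t => t.hom (⟨1⟩ : ULift.{u} ℤ)) (limit.lift_π c (op p))).trans ?_
  exact homOfElement_apply _

end Lim

theorem meet_const {P : Type w} [SemilatticeInf P] (p : P) : meet (fun _ : Fin 1 => p) = p :=
  Finset.inf'_const _ _

theorem eq_of_constCoboundary_eq_zero {V M : Type*} [AddCommGroup M] (c : (Fin 1 → V) → M)
    (hc : constCoboundary c = 0) (x y : Fin 1 → V) : c x = c y := by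
  have h : ∀ z : Fin 1 → V, c z = c (Fin.cons (x 0) Fin.elim0) := fun z => by
    have h1 := congrFun hc (Fin.cons (x 0) z)
    rw [constCoboundary_cons] at h1
    rw [eq_of_sub_eq_zero h1]
    simp [constCoboundary, Subsingleton.elim _ (Fin.elim0 : Fin 0 → V)]
  rw [h x, h y]

section LimCochain

variable {P : Type w} [SemilatticeInf P] [HasLimitsOfShape Pᵒᵖ AddCommGrpCat.{u}]

/-- The embedding of `lim F` in the group of `0`-cochains. -/
def limCochain (F : InvSystem.{u} P) :
    ((lim : InvSystem.{u} P ⥤ AddCommGrpCat.{u}).obj F) →+ strictCochains F 0 :=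
  AddMonoidHom.mk' (fun s => ⟨fun x => limProj F (meet x) s, by
      intro σ x
      obtain rfl : σ = 1 := Subsingleton.elim (α := Equiv.Perm (Fin 1)) σ 1
      rw [bond_limProj]
      simp,
      fun x hx => (hx (Function.injective_of_subsingleton (α := Fin 1) x)).elim⟩)
    fun s t => Subtype.ext (funext fun x => map_add _ _ _)

theorem limCochain_apply (F : InvSystem.{u} P)
    (s : (lim : InvSystem.{u} P ⥤ AddCommGrpCat.{u}).obj F) (x : Fin 1 → P) :
    (limCochain F s).1 x = limProj F (meet x) s := rfl

theorem limCochain_injective (F : InvSystem.{u} P) : Function.Injective (limCochain F) := by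
  intro s t h
  refine lim_ext fun p => ?_
  have h1 : limProj F (meet fun _ : Fin 1 => p) s = limProj F (meet fun _ : Fin 1 => p) t :=
    congrFun (congrArg Subtype.val h) fun _ => p
  rwa [meet_const] at h1

theorem strictD_limCochain (F : InvSystem.{u} P)
    (s : (lim : InvSystem.{u} P ⥤ AddCommGrpCat.{u}).obj F) :
    strictD F 0 (limCochain F s) = 0 := by
  refine Subtype.ext (funext fun x => ?_)
  change coboundary F (limCochain F s).1 x = 0
  change ∑ i : Fin 2, ((-1) ^ (i : ℕ) : ℤ) •
    F.bond (meet_le_meet_comp x i.succAbove) (limProj F (meet (x ∘ i.succAbove)) s) = 0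
  simp only [bond_limProj, Fin.sum_univ_two]
  simp

theorem strictMap_limCochain {F G : InvSystem.{u} P} (φ : F ⟶ G)
    (s : (lim : InvSystem.{u} P ⥤ AddCommGrpCat.{u}).obj F) :
    strictMap φ 0 (limCochain F s) =
      limCochain G ((lim : InvSystem.{u} P ⥤ AddCommGrpCat.{u}).map φ s) :=
  Subtype.ext (funext fun x => (limProj_map φ (meet x) s).symm)

/-- A `0`-cocycle is a compatible family. -/
theorem exists_limCochain_eq {F : InvSystem.{u} P} (y : strictCochains F 0)
    (hy : strictD F 0 y = 0) : ∃ s, limCochain F s = y := by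
  have hloc : ∀ p (x x' : Fin 1 → Set.Ici p), Cochain.localize y.1 p x = y.1.localize p x' :=
    fun p => eq_of_constCoboundary_eq_zero _ (by
      rw [← Cochain.localize_coboundary]
      funext x
      have h : coboundary F y.1 (fun i => (x i).1) = 0 :=
        congrFun (congrArg Subtype.val hy) fun i => (x i).1
      simp only [Cochain.localize, h, map_zero, Pi.zero_apply])
  obtain ⟨s, hs⟩ := exists_lim_of_compatible
    (fun p => Cochain.localize y.1 p fun _ => ⟨p, Set.mem_Ici.2 le_rfl⟩) fun p q h =>
      (F.bond_bond _ _ _).trans (hloc p (fun _ => ⟨q, Set.mem_Ici.2 h⟩) _)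
  refine ⟨s, Subtype.ext (funext fun x => ?_)⟩
  rw [limCochain_apply, hs, hloc _ _ (aboveMeet x), Cochain.localize_aboveMeet]

end LimCochain

/-! ### Cocycles and homology classes in complexes of abelian groups -/

section Homology

variable (K : CochainComplex AddCommGrpCat.{u} ℕ) (n : ℕ)

/-- The cohomology class of a cocycle. -/
def homologyClass : (K.d n (n + 1)).hom.ker →+ K.homology n :=
  (K.liftCycles (AddCommGrpCat.ofHom (K.d n (n + 1)).hom.ker.subtype) (n + 1) (by simp)
    (by ext x; exact x.2) ≫ K.homologyπ n).hom

theorem homologyClass_eq (z : K.cycles n) (x : (K.d n (n + 1)).hom.ker)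
    (h : K.iCycles n z = x.1) : homologyClass K n x = K.homologyπ n z := by
  have hinj : Function.Injective (K.iCycles n) :=
    (AddCommGrpCat.mono_iff_injective _).1 inferInstance
  refine congrArg (K.homologyπ n) (hinj ?_)
  rw [h]
  exact congrArg (fun t => t.hom x)
    (K.liftCycles_i (AddCommGrpCat.ofHom (K.d n (n + 1)).hom.ker.subtype) (n + 1) (by simp)
      (by ext x; exact x.2))

theorem exists_cycles_eq (x : (K.d n (n + 1)).hom.ker) : ∃ z : K.cycles n, K.iCycles n z = x.1 :=
  ⟨_, congrArg (fun t => t.hom x)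
    (K.liftCycles_i (AddCommGrpCat.ofHom (K.d n (n + 1)).hom.ker.subtype) (n + 1) (by simp)
      (by ext x; exact x.2))⟩

theorem homologyClass_surjective : Function.Surjective (homologyClass K n) := by
  intro c
  obtain ⟨z, rfl⟩ := (AddCommGrpCat.epi_iff_surjective (K.homologyπ n)).1 inferInstance c
  refine ⟨⟨K.iCycles n z, ?_⟩, homologyClass_eq K n z _ rfl⟩
  exact congrArg (fun t => t.hom z) (K.iCycles_d n (n + 1))

/-- The degree `m` is arbitrary: for `m + 1 ≠ n` the differential `d m n` is zero. -/
theorem homologyClass_eq_zero_iff (x : (K.d n (n + 1)).hom.ker) :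
    homologyClass K n x = 0 ↔ ∃ m, ∃ y : K.X m, K.d m n y = x.1 := by
  obtain ⟨z, hz⟩ := exists_cycles_eq K n x
  rw [homologyClass_eq K n z x hz]
  have htoCycles : ∀ m (y : K.X m), K.iCycles n (K.toCycles m n y) = K.d m n y := fun m y =>
    congrArg (fun t => t.hom y) (K.toCycles_i m n)
  have hinj : Function.Injective (K.iCycles n) :=
    (AddCommGrpCat.mono_iff_injective _).1 inferInstance
  constructor
  · intro h
    have hex : (ShortComplex.mk (K.toCycles _ n) (K.homologyπ n)
        (K.toCycles_comp_homologyπ ((ComplexShape.up ℕ).prev n) n)).Exact :=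
      ShortComplex.exact_of_g_is_cokernel _ (K.homologyIsCokernel _ n rfl)
    obtain ⟨y, hy⟩ := (ShortComplex.ab_exact_iff _).1 hex z h
    exact ⟨_, y, by rw [← htoCycles, ← hz]; exact congrArg _ hy⟩
  · rintro ⟨m, y, hy⟩
    have : z = K.toCycles m n y := hinj (by rw [htoCycles, hz, hy])
    rw [this]
    exact congrArg (fun t => t.hom y) (K.toCycles_comp_homologyπ m n)

variable {K} in
/-- The image of a cocycle under a morphism of complexes. -/
def mapCocycle {L : CochainComplex AddCommGrpCat.{u} ℕ} (φ : K ⟶ L) :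
    (K.d n (n + 1)).hom.ker →+ (L.d n (n + 1)).hom.ker :=
  ((φ.f n).hom.comp (AddSubgroup.subtype _)).codRestrict _ fun x => by
    have h : L.d n (n + 1) (φ.f n x.1) = φ.f (n + 1) (K.d n (n + 1) x.1) :=
      congrArg (fun t => t.hom x.1) (φ.comm n (n + 1))
    have h0 : K.d n (n + 1) x.1 = 0 := x.2
    rw [h0, map_zero] at h
    exact h

variable {K} in
theorem homologyMap_homologyClass {L : CochainComplex AddCommGrpCat.{u} ℕ} (φ : K ⟶ L)
    (x : (K.d n (n + 1)).hom.ker) :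
    HomologicalComplex.homologyMap φ n (homologyClass K n x) =
      homologyClass L n (mapCocycle n φ x) := by
  obtain ⟨z, hz⟩ := exists_cycles_eq K n x
  rw [homologyClass_eq K n z x hz, homologyClass_eq L n (HomologicalComplex.cyclesMap φ n z)]
  · exact congrArg (fun t => t.hom z) (HomologicalComplex.homologyπ_naturality φ n)
  · refine (congrArg (fun t => t.hom z) (HomologicalComplex.cyclesMap_i φ n)).trans ?_
    exact congrArg (φ.f n) hz

open Classical in
/-- A criterion on the level of cocycles for a family of morphisms of complexes `X α → Y` to
induce an isomorphism from the direct sum of the cohomology groups. -/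
theorem bijective_toAddMonoid_homologyMap {κ : Type w} {Y : CochainComplex AddCommGrpCat.{u} ℕ}
    {X : κ → CochainComplex AddCommGrpCat.{u} ℕ} (g : ∀ α, X α ⟶ Y)
    (hsurj : ∀ y : Y.X n, Y.d n (n + 1) y = 0 → ∃ (T : Finset κ) (x : ∀ α, (X α).X n),
      (∀ α, (X α).d n (n + 1) (x α) = 0) ∧
      ∃ m, ∃ b : Y.X m, Y.d m n b = y - ∑ α ∈ T, (g α).f n (x α))
    (hinj : ∀ (T : Finset κ) (x : ∀ α, (X α).X n), (∀ α, (X α).d n (n + 1) (x α) = 0) →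
      (∃ m, ∃ b : Y.X m, Y.d m n b = ∑ α ∈ T, (g α).f n (x α)) →
      ∀ α ∈ T, ∃ m, ∃ a : (X α).X m, (X α).d m n a = x α) :
    Function.Bijective (DirectSum.toAddMonoid fun α =>
      (HomologicalComplex.homologyMap (g α) n).hom) := by
  have hsum : ∀ (T : Finset κ) (x : ∀ α, ((X α).d n (n + 1)).hom.ker),
      ∑ α ∈ T, HomologicalComplex.homologyMap (g α) n (homologyClass (X α) n (x α)) =
        homologyClass Y n (∑ α ∈ T, mapCocycle n (g α) (x α)) := by
    intro T x
    rw [map_sum]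
    exact Finset.sum_congr rfl fun α _ => homologyMap_homologyClass n (g α) (x α)
  have hval : ∀ (T : Finset κ) (x : ∀ α, ((X α).d n (n + 1)).hom.ker),
      (∑ α ∈ T, mapCocycle n (g α) (x α)).1 = ∑ α ∈ T, (g α).f n (x α).1 := by
    intro T x
    exact map_sum (AddSubgroup.subtype _) _ _
  constructor
  · rw [injective_iff_map_eq_zero]
    intro t ht
    choose x hx using fun α => homologyClass_surjective (X α) n (t α)
    have h1 : DirectSum.toAddMonoid (fun α => (HomologicalComplex.homologyMap (g α) n).hom) t =
        ∑ α ∈ DFinsupp.support t, HomologicalComplex.homologyMap (g α) n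
          (homologyClass (X α) n (x α)) := by
      conv_lhs => rw [← DirectSum.sum_support_of t]
      rw [map_sum]
      refine Finset.sum_congr rfl fun α _ => ?_
      rw [DirectSum.toAddMonoid_of, hx]
    rw [h1, hsum, homologyClass_eq_zero_iff, hval] at ht
    have h2 := hinj _ (fun α => (x α).1) (fun α => (x α).2) ht
    refine DFinsupp.ext fun α => ?_
    by_contra hα
    exact hα ((hx α).symm.trans ((homologyClass_eq_zero_iff _ _ _).2
      (h2 α (DFinsupp.mem_support_iff.2 hα))))
  · intro c
    obtain ⟨y, rfl⟩ := homologyClass_surjective Y n c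
    obtain ⟨T, x, hx, hb⟩ := hsurj y.1 y.2
    let x' : ∀ α, ((X α).d n (n + 1)).hom.ker := fun α => ⟨x α, hx α⟩
    refine ⟨∑ α ∈ T, DirectSum.of (fun α => (X α).homology n) α
      (homologyClass (X α) n (x' α)), ?_⟩
    rw [map_sum]
    simp only [DirectSum.toAddMonoid_of]
    refine (hsum T x').trans ?_
    symm
    rw [← sub_eq_zero, ← map_sub, homologyClass_eq_zero_iff]
    obtain ⟨m, b, hb⟩ := hb
    exact ⟨m, b, by rw [hb, AddSubgroup.coe_sub, hval]⟩

end Homology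

/-! ### Acyclic resolutions compute derived limits -/

section AcyclicResolution

variable {P : Type w} [SemilatticeInf P]

/-- A resolution of the inverse system `F` by cochain-acyclic inverse systems. -/
structure AcyclicResolution (F : InvSystem.{u} P) where
  /-- The complex of inverse systems. -/
  complex : CochainComplex (InvSystem.{u} P) ℕ
  /-- The augmentation. -/
  ι : F ⟶ complex.X 0
  ι_injective : ∀ p, Function.Injective (ι.app (op p))
  ι_d : ι ≫ complex.d 0 1 = 0
  exact_zero : ∀ p (a : (complex.X 0).obj (op p)), (complex.d 0 1).app (op p) a = 0 →
    ∃ g, ι.app (op p) g = a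
  exact_succ : ∀ n p (a : (complex.X (n + 1)).obj (op p)),
    (complex.d (n + 1) (n + 2)).app (op p) a = 0 → ∃ b, (complex.d n (n + 1)).app (op p) b = a
  acyclic : ∀ n, IsCochainAcyclic (complex.X n)

theorem exact_app {S : ShortComplex (InvSystem.{u} P)} (hS : S.Exact) (p : P)
    (b : S.X₂.obj (op p)) (hb : S.g.app (op p) b = 0) : ∃ a, S.f.app (op p) a = b :=
  (ShortComplex.ab_exact_iff _).1 (hS.map ((evaluation _ _).obj (op p))) b hb

theorem strictMap_d_d (K : CochainComplex (InvSystem.{u} P) ℕ) (i j k n : ℕ)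
    (y : strictCochains (K.X i) n) : strictMap (K.d j k) n (strictMap (K.d i j) n y) = 0 := by
  rw [← strictMap_comp, K.d_comp_d, strictMap_zero]

/-- Between two acyclic resolutions of the same system, a morphism of complexes compatible with
the augmentations gives a rowwise quasi-isomorphism of double complexes. -/
def rowwiseQuasiIso {F : InvSystem.{u} P} (S R : AcyclicResolution F)
    (f : S.complex ⟶ R.complex) (hf : S.ι ≫ f.f 0 = R.ι) :
    RowwiseQuasiIso (fun k n => strictCochains (S.complex.X n) k)
      (fun k n => strictCochains (R.complex.X n) k) where
  dA k n := strictMap (S.complex.d n (n + 1)) k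
  dB k n := strictMap (R.complex.d n (n + 1)) k
  δA k n := strictD (S.complex.X n) k
  δB k n := strictD (R.complex.X n) k
  f k n := strictMap (f.f n) k
  dA_dA _ _ _ := strictMap_d_d _ _ _ _ _ _
  dB_dB _ _ _ := strictMap_d_d _ _ _ _ _ _
  δA_δA _ _ := strictD_strictD _ _
  δB_δB _ _ := strictD_strictD _ _
  dA_δA _ _ _ := strictMap_strictD _ _
  dB_δB _ _ _ := strictMap_strictD _ _
  f_dA k n a := by rw [← strictMap_comp, ← strictMap_comp, f.comm]
  f_δA _ _ _ := strictMap_strictD _ _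
  exactA k n := S.acyclic n k
  exactB k n := R.acyclic n k
  cone_mono k a ha hfa := by
    obtain ⟨g, rfl⟩ := exists_strictMap_eq S.ι (S.complex.d 0 1) S.exact_zero a ha
    rw [← strictMap_comp, hf] at hfa
    have hg : g = 0 := Subtype.ext (funext fun x => R.ι_injective _
      ((congrFun (congrArg Subtype.val hfa) x).trans (map_zero _).symm))
    rw [hg, map_zero]
  cone_exact_zero k a b ha hab := by
    obtain ⟨a₁, rfl⟩ := exists_strictMap_eq _ _ (S.exact_succ 0) a ha
    obtain ⟨g, hg⟩ := exists_strictMap_eq R.ι _ R.exact_zero (strictMap (f.f 0) k a₁ - b) (by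
      rw [map_sub, ← hab, ← strictMap_comp, ← strictMap_comp, f.comm, sub_self])
    refine ⟨a₁ - strictMap S.ι k g, ?_, ?_⟩
    · rw [map_sub, ← strictMap_comp, S.ι_d, strictMap_zero, sub_zero]
    · rw [map_sub, ← strictMap_comp, hf, hg, sub_sub_cancel]
  cone_exact_succ k n a b ha hab := by
    obtain ⟨a₁, rfl⟩ := exists_strictMap_eq _ _ (S.exact_succ (n + 1)) a ha
    obtain ⟨b₁, hb₁⟩ := exists_strictMap_eq _ _ (R.exact_succ n) (strictMap (f.f (n + 1)) k a₁ - b)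
      (by rw [map_sub, ← hab, ← strictMap_comp, ← strictMap_comp, f.comm, sub_self])
    exact ⟨a₁, b₁, rfl, by rw [hb₁, sub_sub_cancel]⟩

section

variable [HasLimitsOfShape Pᵒᵖ AddCommGrpCat.{u}]

theorem limCochain_lim_map_eq_zero_iff {F G : InvSystem.{u} P} (φ : F ⟶ G)
    (s : (lim : InvSystem.{u} P ⥤ AddCommGrpCat.{u}).obj F) :
    strictMap φ 0 (limCochain F s) = 0 ↔
      (lim : InvSystem.{u} P ⥤ AddCommGrpCat.{u}).map φ s = 0 := by
  rw [strictMap_limCochain, ← map_zero (limCochain G), (limCochain_injective G).eq_iff]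

variable {F : InvSystem.{u} P} (S R : AcyclicResolution F) (f : S.complex ⟶ R.complex)
  (hf : S.ι ≫ f.f 0 = R.ι)

include hf in
/-- Exactness of the cone of `lim S → lim R`; in degree `0` the cocycle `(a, b)` is the boundary of
`a'` alone, and the last equation says `b = f a'`, as `d m 0 = 0`. -/
theorem exists_lim_of_cone_cocycle (n : ℕ)
    (a : (lim : InvSystem.{u} P ⥤ AddCommGrpCat.{u}).obj (S.complex.X (n + 1)))
    (b : (lim : InvSystem.{u} P ⥤ AddCommGrpCat.{u}).obj (R.complex.X n))
    (ha : lim.map (S.complex.d (n + 1) (n + 2)) a = 0)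
    (hab : lim.map (f.f (n + 1)) a = lim.map (R.complex.d n (n + 1)) b) :
    ∃ a', lim.map (S.complex.d n (n + 1)) a' = a ∧
      ∃ m, ∃ b' : (lim : InvSystem.{u} P ⥤ AddCommGrpCat.{u}).obj (R.complex.X m),
        lim.map (R.complex.d m n) b' = b - lim.map (f.f n) a' := by
  let D := rowwiseQuasiIso S R f hf
  have h1 : strictMap (S.complex.d (n + 1) (n + 2)) 0 (limCochain _ a) = 0 :=
    (limCochain_lim_map_eq_zero_iff _ _).2 ha
  have h2 : strictMap (f.f (n + 1)) 0 (limCochain _ a) =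
      strictMap (R.complex.d n (n + 1)) 0 (limCochain _ b) := by
    rw [strictMap_limCochain, strictMap_limCochain, hab]
  cases n with
  | zero =>
    obtain ⟨a', hδ, e1, e2⟩ := D.exists_closed_zero 0 (limCochain _ a) (limCochain _ b) h1 h2
      (strictD_limCochain _ _) (strictD_limCochain _ _)
    obtain ⟨s, rfl⟩ := exists_limCochain_eq a' hδ
    refine ⟨s, limCochain_injective _ ((strictMap_limCochain _ _).symm.trans e1), 0, 0, ?_⟩
    rw [map_zero, eq_comm, sub_eq_zero]
    exact (limCochain_injective _ ((strictMap_limCochain _ _).symm.trans e2)).symm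
  | succ n =>
    obtain ⟨a', b', hδ, hδ', e1, e2⟩ := D.exists_closed_succ n 0 (limCochain _ a) (limCochain _ b)
      h1 h2 (strictD_limCochain _ _) (strictD_limCochain _ _)
    obtain ⟨s, rfl⟩ := exists_limCochain_eq a' hδ
    obtain ⟨t, rfl⟩ := exists_limCochain_eq b' hδ'
    refine ⟨s, limCochain_injective _ ((strictMap_limCochain _ _).symm.trans e1), n, -t, ?_⟩
    have e3 : strictMap (f.f (n + 1)) 0 (limCochain _ s) -
        strictMap (R.complex.d n (n + 1)) 0 (limCochain _ t) = limCochain _ b := e2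
    rw [strictMap_limCochain, strictMap_limCochain, ← map_sub] at e3
    rw [← limCochain_injective _ e3, map_neg]
    abel

include hf in
/-- `lim S → lim R` is surjective on cohomology. -/
theorem exists_lim_cocycle (n : ℕ)
    (b : (lim : InvSystem.{u} P ⥤ AddCommGrpCat.{u}).obj (R.complex.X n))
    (hb : lim.map (R.complex.d n (n + 1)) b = 0) :
    ∃ a', lim.map (S.complex.d n (n + 1)) a' = 0 ∧
      ∃ m, ∃ b' : (lim : InvSystem.{u} P ⥤ AddCommGrpCat.{u}).obj (R.complex.X m),
        lim.map (R.complex.d m n) b' = b - lim.map (f.f n) a' :=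
  exists_lim_of_cone_cocycle S R f hf n 0 b (map_zero _) (by rw [map_zero, hb])

include hf in
/-- `lim S → lim R` is injective on cohomology. The degree `m` is arbitrary, to include degree `0`:
all differentials `d m n` with `m + 1 ≠ n` vanish. -/
theorem exists_lim_coboundary (n : ℕ)
    (a : (lim : InvSystem.{u} P ⥤ AddCommGrpCat.{u}).obj (S.complex.X n))
    (ha : lim.map (S.complex.d n (n + 1)) a = 0) (m : ℕ)
    (b : (lim : InvSystem.{u} P ⥤ AddCommGrpCat.{u}).obj (R.complex.X m))
    (hab : lim.map (R.complex.d m n) b = lim.map (f.f n) a) :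
    ∃ m, ∃ a' : (lim : InvSystem.{u} P ⥤ AddCommGrpCat.{u}).obj (S.complex.X m),
      lim.map (S.complex.d m n) a' = a := by
  by_cases hmn : m + 1 = n
  · subst hmn
    obtain ⟨a', h, -⟩ := exists_lim_of_cone_cocycle S R f hf m a b ha hab.symm
    exact ⟨m, a', h⟩
  · have h0 : lim.map (f.f n) a = 0 := by
      rw [← hab, R.complex.shape _ _ hmn, Functor.map_zero]
      rfl
    cases n with
    | zero =>
      have : limCochain _ a = 0 := (rowwiseQuasiIso S R f hf).cone_mono 0 _
        ((limCochain_lim_map_eq_zero_iff _ _).2 ha) ((limCochain_lim_map_eq_zero_iff _ _).2 h0)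
      refine ⟨0, 0, ?_⟩
      rw [map_zero, limCochain_injective _ (this.trans (map_zero _).symm)]
    | succ n =>
      obtain ⟨a', h, -⟩ := exists_lim_of_cone_cocycle S R f hf n a 0 ha (by rw [h0, map_zero])
      exact ⟨n, a', h⟩

end

end AcyclicResolution

/-- An injective resolution is an acyclic resolution. -/
def AcyclicResolution.ofInjectiveResolution {P : Type u} [SemilatticeInf P] {F : InvSystem.{u} P}
    (I : InjectiveResolution F) : AcyclicResolution F where
  complex := I.cocomplex
  ι := I.ι.f 0
  ι_injective p := (AddCommGrpCat.mono_iff_injective _).1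
    (inferInstanceAs (Mono (((evaluation _ _).obj (op p)).map (I.ι.f 0))))
  ι_d := I.ι_f_zero_comp_complex_d
  exact_zero p := exact_app I.exact₀ p
  exact_succ n p := exact_app (I.exact_succ n) p
  acyclic n := isCochainAcyclic_of_injective (I.cocomplex.X n)

/-! ### The system `G` as a coproduct -/

section SumSystem

variable {κ : Type u}

theorem summandInclusion_apply_same (𝒢 : OmegaSystem κ) (α : κ) (x : κ → ℕ)
    (a : (𝒢 α).obj (op (x α))) : ((summandInclusion 𝒢 α).app (op x) a).1 α = a := by
  classical
  exact Pi.single_eq_same (M := fun β => (𝒢 β).obj (op (x β))) α a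

theorem summandInclusion_apply_of_ne (𝒢 : OmegaSystem κ) {α β : κ} (h : β ≠ α) (x : κ → ℕ)
    (a : (𝒢 α).obj (op (x α))) : ((summandInclusion 𝒢 α).app (op x) a).1 β = 0 := by
  classical
  exact Pi.single_eq_of_ne (M := fun β => (𝒢 β).obj (op (x β))) h a

/-- The evaluation of an element of `⨁_α G_{α,x(α)}` at `α`. -/
def sumEval (𝒢 : OmegaSystem κ) (x : κ → ℕ) (α : κ) :
    (sumSystem 𝒢).obj (op x) →+ (𝒢 α).obj (op (x α)) :=
  (Pi.evalAddMonoidHom (fun β => (𝒢 β).obj (op (x β))) α).comp (AddSubgroup.subtype _)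

theorem sumEval_summandInclusion_sum (𝒢 : OmegaSystem κ) (x : κ → ℕ) (T : Finset κ)
    (a : ∀ α, (𝒢 α).obj (op (x α))) {β : κ} (hβ : β ∈ T) :
    sumEval 𝒢 x β (∑ α ∈ T, (summandInclusion 𝒢 α).app (op x) (a α)) = a β := by
  refine (map_sum (sumEval 𝒢 x β) (fun α => (summandInclusion 𝒢 α).app (op x) (a α)) T).trans ?_
  rw [Finset.sum_eq_single_of_mem β hβ]
  · exact summandInclusion_apply_same 𝒢 β x (a β)
  · intro α _ hα
    exact summandInclusion_apply_of_ne 𝒢 hα.symm x (a α)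

theorem sumEval_summandInclusion_sum_of_notMem (𝒢 : OmegaSystem κ) (x : κ → ℕ) (T : Finset κ)
    (a : ∀ α, (𝒢 α).obj (op (x α))) {β : κ} (hβ : β ∉ T) :
    sumEval 𝒢 x β (∑ α ∈ T, (summandInclusion 𝒢 α).app (op x) (a α)) = 0 := by
  refine (map_sum (sumEval 𝒢 x β) (fun α => (summandInclusion 𝒢 α).app (op x) (a α)) T).trans ?_
  refine Finset.sum_eq_zero fun α hα => ?_
  exact summandInclusion_apply_of_ne 𝒢 (by rintro rfl; exact hβ hα) x (a α)

/-- Every element of `⨁_α G_{α,x(α)}` is the sum of its finitely many nonzero components. -/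
theorem eq_sum_summandInclusion (𝒢 : OmegaSystem κ) (x : κ → ℕ)
    (a : (sumSystem 𝒢).obj (op x)) :
    a = ∑ α ∈ Set.Finite.toFinset a.2, (summandInclusion 𝒢 α).app (op x) (a.1 α) := by
  refine Subtype.ext (funext fun β => ?_)
  by_cases hβ : β ∈ Set.Finite.toFinset a.2
  · exact (sumEval_summandInclusion_sum 𝒢 x _ a.1 hβ).symm
  · refine Eq.trans ?_ (sumEval_summandInclusion_sum_of_notMem 𝒢 x _ a.1 hβ).symm
    by_contra h
    exact hβ ((Set.Finite.mem_toFinset _).2 h)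

theorem sumSystem_hom_ext {𝒢 : OmegaSystem κ} {R : InvSystem.{u} (κ → ℕ)}
    {φ ψ : sumSystem 𝒢 ⟶ R}
    (h : ∀ α, summandInclusion 𝒢 α ≫ φ = summandInclusion 𝒢 α ≫ ψ) : φ = ψ := by
  ext x a
  change φ.app (op x.unop) a = ψ.app (op x.unop) a
  rw [eq_sum_summandInclusion 𝒢 x.unop a, map_sum, map_sum]
  exact Finset.sum_congr rfl fun α _ =>
    congrArg (fun t => (t.app x).hom (a.1 α)) (h α)

theorem finite_support_app {𝒢 : OmegaSystem κ} {R : InvSystem.{u} (κ → ℕ)}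
    (φ : ∀ α, (pullback (evalAt α)).obj (𝒢 α) ⟶ R) (x : (κ → ℕ)ᵒᵖ) (a : (sumSystem 𝒢).obj x) :
    (Function.support fun α => (φ α).app x (a.1 α)).Finite :=
  Set.Finite.subset a.2 fun α hα h0 => hα ((congrArg ((φ α).app x) h0).trans (map_zero _))

/-- The universal property of the coproduct: the morphism `G → R` with given restrictions to the
summands `x ↦ G_{α,x(α)}`. -/
def sumDesc {𝒢 : OmegaSystem κ} {R : InvSystem.{u} (κ → ℕ)}
    (φ : ∀ α, (pullback (evalAt α)).obj (𝒢 α) ⟶ R) : sumSystem 𝒢 ⟶ R where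
  app x := AddCommGrpCat.ofHom (AddMonoidHom.mk' (fun a => ∑ᶠ α, (φ α).app x (a.1 α)) fun a b => by
    rw [← finsum_add_distrib (finite_support_app φ x a) (finite_support_app φ x b)]
    exact finsum_congr fun α => map_add _ _ _)
  naturality x y f := by
    refine AddCommGrpCat.hom_ext (AddMonoidHom.ext fun a => ?_)
    refine Eq.trans ?_ ((R.map f).hom.map_finsum (finite_support_app φ x a)).symm
    exact finsum_congr fun α => congrArg (fun t => t.hom (a.1 α)) ((φ α).naturality f)

theorem summandInclusion_sumDesc {𝒢 : OmegaSystem κ} {R : InvSystem.{u} (κ → ℕ)}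
    (φ : ∀ α, (pullback (evalAt α)).obj (𝒢 α) ⟶ R) (α : κ) :
    summandInclusion 𝒢 α ≫ sumDesc φ = φ α := by
  ext x a
  refine (finsum_eq_single _ α fun β hβ => ?_).trans ?_
  · exact (congrArg ((φ β).app x) (summandInclusion_apply_of_ne 𝒢 hβ x.unop a)).trans (map_zero _)
  · exact congrArg ((φ α).app x) (summandInclusion_apply_same 𝒢 α x.unop a)

/-- The morphism of the systems `G` induced by a morphism of `Ω_κ` systems. -/
def sumMap {𝒢 ℋ : OmegaSystem κ} (φ : ∀ α, 𝒢 α ⟶ ℋ α) : sumSystem 𝒢 ⟶ sumSystem ℋ where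
  app x := AddCommGrpCat.ofHom (AddMonoidHom.mk'
    (fun a => ⟨fun α => (φ α).app (op (x.unop α)) (a.1 α), Set.Finite.subset a.2 fun α hα h0 =>
      hα ((congrArg ((φ α).app (op (x.unop α))) h0).trans (map_zero _))⟩)
    fun a b => Subtype.ext (funext fun α => map_add _ _ _))
  naturality x y f := by
    refine AddCommGrpCat.hom_ext (AddMonoidHom.ext fun a => Subtype.ext (funext fun α => ?_))
    exact InvSystem.app_bond (φ α) (leOfHom f.unop α) (a.1 α)

theorem summandInclusion_sumMap {𝒢 ℋ : OmegaSystem κ} (φ : ∀ α, 𝒢 α ⟶ ℋ α) (α : κ) :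
    summandInclusion 𝒢 α ≫ sumMap φ =
      (pullback (evalAt α)).map (φ α) ≫ summandInclusion ℋ α := by
  refine NatTrans.ext (funext fun x => AddCommGrpCat.hom_ext (AddMonoidHom.ext fun a =>
    Subtype.ext (funext fun β => ?_)))
  by_cases hβ : β = α
  · subst hβ
    refine (congrArg ((φ β).app (op (x.unop β)))
      (summandInclusion_apply_same 𝒢 β x.unop a)).trans ?_
    exact (summandInclusion_apply_same ℋ β x.unop _).symm
  · refine (congrArg ((φ β).app (op (x.unop β)))
      (summandInclusion_apply_of_ne 𝒢 hβ x.unop a)).trans ((map_zero _).trans ?_)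
    exact (summandInclusion_apply_of_ne ℋ hβ x.unop _).symm

/-- The functors `𝒢 ↦ G_x` are exact. -/
theorem exists_sumMap_eq {ℱ 𝒢 ℋ : OmegaSystem κ} (φ : ∀ α, ℱ α ⟶ 𝒢 α) (ψ : ∀ α, 𝒢 α ⟶ ℋ α)
    (hex : ∀ α k (b : (𝒢 α).obj (op k)), (ψ α).app (op k) b = 0 → ∃ a, (φ α).app (op k) a = b)
    (x : κ → ℕ) (b : (sumSystem 𝒢).obj (op x)) (hb : (sumMap ψ).app (op x) b = 0) :
    ∃ a, (sumMap φ).app (op x) a = b := by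
  classical
  choose a ha using fun α => hex α (x α) (b.1 α) (congrFun (congrArg Subtype.val hb) α)
  -- The preimage of a vanishing component is taken to be zero.
  refine ⟨⟨fun α => if b.1 α = 0 then 0 else a α, Set.Finite.subset b.2 fun α hα h0 =>
    hα (if_pos h0)⟩, Subtype.ext (funext fun α => ?_)⟩
  by_cases h0 : b.1 α = 0
  · exact (congrArg ((φ α).app (op (x α))) (if_pos h0)).trans ((map_zero _).trans h0.symm)
  · exact (congrArg ((φ α).app (op (x α))) (if_neg h0)).trans (ha α)

/-- Injective resolutions of the sequences `𝒢_α` give a resolution of `G`, whose terms are acyclic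
by the triviality of coherent families. -/
def sumResolution
    (h : ∀ ℐ : OmegaSystem κ, ℐ.IsInjective →
      ∀ (m : ℕ) (Φ : Cochain (prodSystem ℐ) m), IsCoherent ℐ m Φ → IsTrivial ℐ m Φ)
    {𝒢 : OmegaSystem κ} (I : ∀ α, InjectiveResolution (𝒢 α)) :
    AcyclicResolution (sumSystem 𝒢) where
  complex :=
    { X := fun n => sumSystem fun α => (I α).cocomplex.X n
      d := fun i j => sumMap fun α => (I α).cocomplex.d i j
      shape := fun i j hij => by
        refine NatTrans.ext (funext fun x => AddCommGrpCat.hom_ext (AddMonoidHom.ext fun a =>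
          Subtype.ext (funext fun α => ?_)))
        exact congrArg (fun t => (t.app (op (x.unop α))).hom (a.1 α))
          ((I α).cocomplex.shape i j hij)
      d_comp_d' := fun i j k _ _ => by
        refine NatTrans.ext (funext fun x => AddCommGrpCat.hom_ext (AddMonoidHom.ext fun a =>
          Subtype.ext (funext fun α => ?_)))
        exact congrArg (fun t => (t.app (op (x.unop α))).hom (a.1 α))
          ((I α).cocomplex.d_comp_d i j k) }
  ι := sumMap fun α => (I α).ι.f 0
  ι_injective x a b hab := by
    refine Subtype.ext (funext fun α => ?_)
    exact (AddCommGrpCat.mono_iff_injective _).1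
      (inferInstanceAs (Mono (((evaluation _ _).obj (op (x α))).map ((I α).ι.f 0))))
      (congrFun (congrArg Subtype.val hab) α)
  ι_d := by
    refine NatTrans.ext (funext fun x => AddCommGrpCat.hom_ext (AddMonoidHom.ext fun a =>
      Subtype.ext (funext fun α => ?_)))
    exact congrArg (fun t => (t.app (op (x.unop α))).hom (a.1 α)) (I α).ι_f_zero_comp_complex_d
  exact_zero x := exists_sumMap_eq _ _ (fun α k => exact_app (I α).exact₀ k) x
  exact_succ n x := exists_sumMap_eq _ _ (fun α k => exact_app ((I α).exact_succ n) k) x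
  acyclic n := isCochainAcyclic_sumSystem _ (fun α => (I α).injective n)
    (h _ (isInjective_of_injective _ fun α => (I α).injective n))

/-! ### The inverse limit of `G` -/

/-- The map `lim 𝒢_α → lim G` induced by the inclusion of a summand. -/
def limSummand (𝒢 : OmegaSystem κ) (α : κ) :
    (lim : InvSystem.{u} ℕ ⥤ AddCommGrpCat.{u}).obj (𝒢 α) ⟶
      (lim : InvSystem.{u} (κ → ℕ) ⥤ AddCommGrpCat.{u}).obj (sumSystem 𝒢) :=
  (limComparison (evalAt α)).app (𝒢 α) ≫ lim.map (summandInclusion 𝒢 α)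

theorem limProj_limComparison (α : κ) (F : InvSystem.{u} ℕ) (x : κ → ℕ)
    (s : (lim : InvSystem.{u} ℕ ⥤ AddCommGrpCat.{u}).obj F) :
    limProj ((pullback (evalAt α)).obj F) x ((limComparison (evalAt α)).app F s) =
      limProj F (x α) s :=
  congrArg (fun t => t.hom s) (limit.pre_π F (evalAt α).monotone.functor.op (op x))

theorem limProj_limSummand (𝒢 : OmegaSystem κ) (α : κ) (x : κ → ℕ)
    (s : (lim : InvSystem.{u} ℕ ⥤ AddCommGrpCat.{u}).obj (𝒢 α)) :
    limProj (sumSystem 𝒢) x (limSummand 𝒢 α s) =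
      (summandInclusion 𝒢 α).app (op x) (limProj (𝒢 α) (x α) s) := by
  refine (limProj_map (summandInclusion 𝒢 α) x _).trans ?_
  exact congrArg ((summandInclusion 𝒢 α).app (op x)) (limProj_limComparison α (𝒢 α) x s)

theorem limSummand_sumMap {𝒢 ℋ : OmegaSystem κ} (φ : ∀ α, 𝒢 α ⟶ ℋ α) (α : κ) :
    limSummand 𝒢 α ≫ lim.map (sumMap φ) = lim.map (φ α) ≫ limSummand ℋ α := by
  have h := (limComparison (evalAt α)).naturality (φ α)
  rw [limSummand, limSummand, Category.assoc, ← Functor.map_comp, summandInclusion_sumMap,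
    Functor.map_comp, ← Category.assoc, ← Category.assoc, h]
  rfl

/-- Distinct summands of `lim G` are independent. -/
theorem eq_of_sum_limSummand_eq (𝒢 : OmegaSystem κ) (T T' : Finset κ)
    (a b : ∀ α, (lim : InvSystem.{u} ℕ ⥤ AddCommGrpCat.{u}).obj (𝒢 α))
    (hb : ∀ α, α ∉ T' → b α = 0)
    (h : ∑ α ∈ T, limSummand 𝒢 α (a α) = ∑ α ∈ T', limSummand 𝒢 α (b α)) :
    ∀ α ∈ T, a α = b α := by
  intro α hα
  refine lim_ext fun k => ?_
  have h1 := congrArg (fun s => sumEval 𝒢 (fun _ => k) α (limProj (sumSystem 𝒢) (fun _ => k) s)) h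
  simp only [map_sum (limProj (sumSystem 𝒢) fun _ => k), limProj_limSummand] at h1
  rw [sumEval_summandInclusion_sum 𝒢 (fun _ => k) T (fun α => limProj (𝒢 α) k (a α)) hα] at h1
  by_cases hα' : α ∈ T'
  · rwa [sumEval_summandInclusion_sum 𝒢 (fun _ => k) T' (fun α => limProj (𝒢 α) k (b α)) hα'] at h1
  · rw [sumEval_summandInclusion_sum_of_notMem 𝒢 (fun _ => k) T'
      (fun α => limProj (𝒢 α) k (b α)) hα'] at h1
    rw [hb α hα', map_zero]
    exact h1

/-- `lim G` is the direct sum of the groups `lim 𝒢_α`. The component at `α` of a compatible family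
`s` depends on `x(α)` only, and gives an element of `lim 𝒢_α`; if infinitely many of these were
nonzero, then choosing `x(α)` such that they are nonzero at `x(α)` would give a value `s_x` of
infinite support. -/
theorem exists_eq_sum_limSummand (𝒢 : OmegaSystem κ)
    (s : (lim : InvSystem.{u} (κ → ℕ) ⥤ AddCommGrpCat.{u}).obj (sumSystem 𝒢)) :
    ∃ (T : Finset κ) (a : ∀ α, (lim : InvSystem.{u} ℕ ⥤ AddCommGrpCat.{u}).obj (𝒢 α)),
      (∀ α, α ∉ T → a α = 0) ∧ s = ∑ α ∈ T, limSummand 𝒢 α (a α) := by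
  classical
  let c : ∀ α, (k : ℕ) → (𝒢 α).obj (op k) := fun α k =>
    sumEval 𝒢 (fun _ => k) α (limProj (sumSystem 𝒢) (fun _ => k) s)
  have hbond : ∀ (x y : κ → ℕ) (h : x ≤ y) (α : κ),
      (𝒢 α).bond (h α) (sumEval 𝒢 y α (limProj (sumSystem 𝒢) y s)) =
        sumEval 𝒢 x α (limProj (sumSystem 𝒢) x s) := fun x y h α =>
    congrArg (sumEval 𝒢 x α) (bond_limProj (sumSystem 𝒢) h s)
  choose a ha using fun α => exists_lim_of_compatible (c α) fun p q h =>
    hbond (fun _ => p) (fun _ => q) (fun _ => h) α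
  have hc : ∀ (x : κ → ℕ) (α : κ), c α (x α) = sumEval 𝒢 x α (limProj (sumSystem 𝒢) x s) := by
    intro x α
    -- Both are restrictions of the component at the pointwise maximum.
    have h1 := hbond (fun _ => x α) (x ⊔ fun _ => x α) le_sup_right α
    have h2 := hbond x (x ⊔ fun _ => x α) le_sup_left α
    exact h1.symm.trans h2
  have hfin : {α | a α ≠ 0}.Finite := by
    have hk : ∀ α, ∃ k, a α ≠ 0 → c α k ≠ 0 := by
      intro α
      by_cases h0 : a α = 0
      · exact ⟨0, fun h => (h h0).elim⟩
      · by_contra! hk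
        exact h0 (lim_ext fun p => by rw [ha, map_zero, (hk p).2])
    choose x hx using hk
    refine Set.Finite.subset (limProj (sumSystem 𝒢) x s).2 fun α hα h0 => hx α hα ?_
    rw [hc]
    exact h0
  refine ⟨hfin.toFinset, a, fun α hα => by simpa using hα, lim_ext fun x => ?_⟩
  rw [map_sum]
  simp only [limProj_limSummand, ha, hc]
  refine Subtype.ext (funext fun β => ?_)
  by_cases hβ : β ∈ hfin.toFinset
  · exact (sumEval_summandInclusion_sum 𝒢 x _
      (fun α => sumEval 𝒢 x α (limProj (sumSystem 𝒢) x s)) hβ).symm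
  · refine Eq.trans ?_ (sumEval_summandInclusion_sum_of_notMem 𝒢 x _
      (fun α => sumEval 𝒢 x α (limProj (sumSystem 𝒢) x s)) hβ).symm
    have h0 : a β = 0 := by simpa using hβ
    exact ((hc x β).symm.trans (ha β (x β)).symm).trans (by rw [h0, map_zero])

end SumSystem

/-! ### The canonical map on the level of resolutions -/

section CanonicalMap

section PullbackResolution

variable {P : Type w} {Q : Type w'} [Preorder P] [Preorder Q] (e : P →o Q) (s : Q →o P)
  (hs : GaloisConnection s e) {F : InvSystem.{u} Q} (I : InjectiveResolution F)

theorem pullbackResolution_ι_f_zero :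
    (pullbackResolution e s hs I).ι.f 0 = (pullback e).map (I.ι.f 0) := by
  have h : (pullbackResolution e s hs I).ι.f 0 =
      ((HomologicalComplex.singleObjXSelf (ComplexShape.up ℕ) 0 ((pullback e).obj F)).hom ≫
        (pullback e).map (HomologicalComplex.singleObjXSelf (ComplexShape.up ℕ) 0 F).inv) ≫
      (pullback e).map (I.ι.f 0) :=
    congrArg (fun t => t ≫ (pullback e).map (I.ι.f 0))
      (HomologicalComplex.singleMapHomologicalComplex_inv_app_self (pullback e)
        (ComplexShape.up ℕ) 0 F)
  rw [h]
  rfl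

end PullbackResolution

variable {κ : Type u} (𝒢 : OmegaSystem κ)

/-- A morphism between resolutions lifting the inclusion of the `α`-th summand. -/
def resolutionDesc (α : κ) :
    (pullbackResolution (evalAt α) (singleAt α) (singleAt_gc α)
      (injectiveResolution (𝒢 α))).cocomplex ⟶
      (injectiveResolution (sumSystem 𝒢)).cocomplex :=
  InjectiveResolution.desc (summandInclusion 𝒢 α) _ _

/-- The component of `resolutionDesc` in degree `n`. -/
def resolutionDescApp (α : κ) (n : ℕ) :
    (pullback (evalAt α)).obj ((injectiveResolution (𝒢 α)).cocomplex.X n) ⟶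
      (injectiveResolution (sumSystem 𝒢)).cocomplex.X n :=
  (resolutionDesc 𝒢 α).f n

theorem map_ι_resolutionDesc (α : κ) :
    (pullback (evalAt α)).map ((injectiveResolution (𝒢 α)).ι.f 0) ≫ resolutionDescApp 𝒢 α 0 =
      summandInclusion 𝒢 α ≫ (injectiveResolution (sumSystem 𝒢)).ι.f 0 := by
  rw [← pullbackResolution_ι_f_zero (evalAt α) (singleAt α) (singleAt_gc α)]
  exact InjectiveResolution.desc_commutes_zero _ _ _

/-- The map `lim I_α → lim R` of complexes, for the chosen injective resolutions `I_α` of `𝒢_α` and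
`R` of `G`, which induces the canonical map on cohomology. -/
def limResolutionMap (α : κ) :
    ((lim : InvSystem.{u} ℕ ⥤ AddCommGrpCat.{u}).mapHomologicalComplex (ComplexShape.up ℕ)).obj
      (injectiveResolution (𝒢 α)).cocomplex ⟶
    ((lim : InvSystem.{u} (κ → ℕ) ⥤ AddCommGrpCat.{u}).mapHomologicalComplex
      (ComplexShape.up ℕ)).obj (injectiveResolution (sumSystem 𝒢)).cocomplex :=
  (NatTrans.mapHomologicalComplex (limComparison (evalAt α)) _).app
    (injectiveResolution (𝒢 α)).cocomplex ≫
    ((lim : InvSystem.{u} (κ → ℕ) ⥤ AddCommGrpCat.{u}).mapHomologicalComplex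
      (ComplexShape.up ℕ)).map (resolutionDesc 𝒢 α)

theorem canonicalComponent_eq (n : ℕ) (α : κ) :
    canonicalComponent 𝒢 n α =
      ((injectiveResolution (𝒢 α)).isoRightDerivedObj lim n).hom ≫
        HomologicalComplex.homologyMap (limResolutionMap 𝒢 α) n ≫
        ((injectiveResolution (sumSystem 𝒢)).isoRightDerivedObj lim n).inv := by
  have h := InjectiveResolution.isoRightDerivedObj_inv_naturality (summandInclusion 𝒢 α)
    (pullbackResolution (evalAt α) (singleAt α) (singleAt_gc α) (injectiveResolution (𝒢 α)))
    (injectiveResolution (sumSystem 𝒢)) (resolutionDesc 𝒢 α)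
    (InjectiveResolution.desc_commutes_zero _ _ _)
    (lim : InvSystem.{u} (κ → ℕ) ⥤ AddCommGrpCat.{u}) n
  refine (Category.assoc _ _ _).trans (congrArg (_ ≫ ·) ((Category.assoc _ _ _).trans
    ((congrArg (_ ≫ ·) h).trans ((Category.assoc _ _ _).symm.trans (congrArg (· ≫ _) ?_)))))
  exact (HomologicalComplex.homologyMap_comp _ _ n).symm

section

variable (h : ∀ ℐ : OmegaSystem κ, ℐ.IsInjective →
  ∀ (m : ℕ) (Φ : Cochain (prodSystem ℐ) m), IsCoherent ℐ m Φ → IsTrivial ℐ m Φ)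

/-- The morphism from the resolution `⨁_α I_α` of `G` to the chosen injective resolution. -/
def sumResolutionDesc :
    (sumResolution h fun α => injectiveResolution (𝒢 α)).complex ⟶
      (injectiveResolution (sumSystem 𝒢)).cocomplex where
  f n := sumDesc fun α => resolutionDescApp 𝒢 α n
  comm' i j _ := by
    refine sumSystem_hom_ext fun α => ?_
    change summandInclusion (fun α => (injectiveResolution (𝒢 α)).cocomplex.X i) α ≫
      sumDesc (fun α => resolutionDescApp 𝒢 α i) ≫ _ = summandInclusion _ α ≫
      sumMap (fun α => (injectiveResolution (𝒢 α)).cocomplex.d i j) ≫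
      sumDesc fun α => resolutionDescApp 𝒢 α j
    rw [← Category.assoc, summandInclusion_sumDesc, ← Category.assoc, summandInclusion_sumMap,
      Category.assoc, summandInclusion_sumDesc]
    exact (resolutionDesc 𝒢 α).comm i j

theorem ι_sumResolutionDesc :
    (sumResolution h fun α => injectiveResolution (𝒢 α)).ι ≫ (sumResolutionDesc 𝒢 h).f 0 =
      (injectiveResolution (sumSystem 𝒢)).ι.f 0 := by
  refine sumSystem_hom_ext fun α => ?_
  change summandInclusion _ α ≫ sumMap (fun α => (injectiveResolution (𝒢 α)).ι.f 0) ≫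
      sumDesc (fun α => resolutionDescApp 𝒢 α 0) = _
  rw [← Category.assoc, summandInclusion_sumMap, Category.assoc, summandInclusion_sumDesc]
  exact map_ι_resolutionDesc 𝒢 α

theorem lim_map_sumResolutionDesc (n : ℕ) (α : κ)
    (a : (lim : InvSystem.{u} ℕ ⥤ AddCommGrpCat.{u}).obj
      ((injectiveResolution (𝒢 α)).cocomplex.X n)) :
    lim.map ((sumResolutionDesc 𝒢 h).f n)
      (limSummand (fun α => (injectiveResolution (𝒢 α)).cocomplex.X n) α a) =
      (limResolutionMap 𝒢 α).f n a := by
  have e : limSummand (fun α => (injectiveResolution (𝒢 α)).cocomplex.X n) α ≫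
      lim.map (sumDesc fun α => resolutionDescApp 𝒢 α n) = (limResolutionMap 𝒢 α).f n := by
    rw [limSummand, Category.assoc, ← Functor.map_comp, summandInclusion_sumDesc]
    rfl
  exact congrArg (fun t => t.hom a) e

theorem lim_map_sumResolution_d (m n : ℕ) (T : Finset κ)
    (a : ∀ α, (lim : InvSystem.{u} ℕ ⥤ AddCommGrpCat.{u}).obj
      ((injectiveResolution (𝒢 α)).cocomplex.X m)) :
    lim.map ((sumResolution h fun α => injectiveResolution (𝒢 α)).complex.d m n)
      (∑ α ∈ T, limSummand (fun α => (injectiveResolution (𝒢 α)).cocomplex.X m) α (a α)) =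
      ∑ α ∈ T, limSummand (fun α => (injectiveResolution (𝒢 α)).cocomplex.X n) α
        (lim.map ((injectiveResolution (𝒢 α)).cocomplex.d m n) (a α)) := by
  refine (map_sum (lim.map ((sumResolution h fun α =>
    injectiveResolution (𝒢 α)).complex.d m n)).hom _ T).trans ?_
  exact Finset.sum_congr rfl fun α _ => congrArg (fun t => t.hom (a α))
    (limSummand_sumMap (fun α => (injectiveResolution (𝒢 α)).cocomplex.d m n) α)

theorem lim_map_sumResolutionDesc_sum (n : ℕ) (T : Finset κ)
    (a : ∀ α, (lim : InvSystem.{u} ℕ ⥤ AddCommGrpCat.{u}).obj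
      ((injectiveResolution (𝒢 α)).cocomplex.X n)) :
    lim.map ((sumResolutionDesc 𝒢 h).f n)
      (∑ α ∈ T, limSummand (fun α => (injectiveResolution (𝒢 α)).cocomplex.X n) α (a α)) =
      ∑ α ∈ T, (limResolutionMap 𝒢 α).f n (a α) := by
  refine (map_sum (lim.map ((sumResolutionDesc 𝒢 h).f n)).hom _ T).trans ?_
  exact Finset.sum_congr rfl fun α _ => lim_map_sumResolutionDesc 𝒢 h n α (a α)

open Classical in
include h in
theorem bijective_homologyMap_limResolutionMap (n : ℕ) :
    Function.Bijective (DirectSum.toAddMonoid fun α =>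
      (HomologicalComplex.homologyMap (limResolutionMap 𝒢 α) n).hom) := by
  have hf := ι_sumResolutionDesc 𝒢 h
  refine bijective_toAddMonoid_homologyMap n (limResolutionMap 𝒢) ?_ ?_
  · intro y hy
    obtain ⟨s, hs, m, b, hb⟩ := exists_lim_cocycle _
      (AcyclicResolution.ofInjectiveResolution (injectiveResolution (sumSystem 𝒢)))
      (sumResolutionDesc 𝒢 h) hf n y hy
    obtain ⟨T, a, ha, rfl⟩ := exists_eq_sum_limSummand
      (fun α => (injectiveResolution (𝒢 α)).cocomplex.X n) s
    refine ⟨T, a, fun α => ?_, m, b, ?_⟩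
    · by_cases hα : α ∈ T
      · refine eq_of_sum_limSummand_eq (fun α => (injectiveResolution (𝒢 α)).cocomplex.X (n + 1))
          T ∅ (fun α => lim.map ((injectiveResolution (𝒢 α)).cocomplex.d n (n + 1)) (a α))
          (fun _ => 0) (fun _ _ => rfl) ?_ α hα
        exact (lim_map_sumResolution_d 𝒢 h n (n + 1) T a).symm.trans hs
      · rw [ha α hα]
        exact map_zero (lim.map ((injectiveResolution (𝒢 α)).cocomplex.d n (n + 1))).hom
    · rw [← lim_map_sumResolutionDesc_sum 𝒢 h n T a]
      exact hb
  · rintro T x hx ⟨m, b, hb⟩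
    rw [← lim_map_sumResolutionDesc_sum 𝒢 h n T x] at hb
    obtain ⟨m', s, hs⟩ := exists_lim_coboundary _
      (AcyclicResolution.ofInjectiveResolution (injectiveResolution (sumSystem 𝒢)))
      (sumResolutionDesc 𝒢 h) hf n
      (∑ α ∈ T, limSummand (fun α => (injectiveResolution (𝒢 α)).cocomplex.X n) α (x α))
      (by
        refine (lim_map_sumResolution_d 𝒢 h n (n + 1) T x).trans (Finset.sum_eq_zero fun α _ => ?_)
        exact (congrArg _ (hx α)).trans (map_zero _)) m b hb
    obtain ⟨T', a, ha, rfl⟩ := exists_eq_sum_limSummand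
      (fun α => (injectiveResolution (𝒢 α)).cocomplex.X m') s
    intro α hα
    refine ⟨m', a α, ?_⟩
    refine (eq_of_sum_limSummand_eq (fun α => (injectiveResolution (𝒢 α)).cocomplex.X n) T T' x
      (fun α => lim.map ((injectiveResolution (𝒢 α)).cocomplex.d m' n) (a α))
      (fun β hβ => by rw [ha β hβ, map_zero]) ?_ α hα).symm
    exact hs.symm.trans (lim_map_sumResolution_d 𝒢 h m' n T' a)

end

open Classical in
/-- Bijectivity of the map out of a direct sum is unaffected by isomorphisms of the summands and of
the target. -/
theorem bijective_toAddMonoid_of_iso {A B : κ → AddCommGrpCat.{u}} {C D : AddCommGrpCat.{u}}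
    (e : ∀ α, A α ≅ B α) (e' : D ≅ C) (g : ∀ α, B α ⟶ D)
    (hg : Function.Bijective (DirectSum.toAddMonoid fun α => (g α).hom)) :
    Function.Bijective (DirectSum.toAddMonoid fun α => ((e α).hom ≫ g α ≫ e'.hom).hom) := by
  let E := DirectSum.map fun α => (e α).hom.hom
  have hE : Function.Bijective E := by
    refine ⟨(DirectSum.map_injective _).2 fun α => ?_, (DirectSum.map_surjective _).2 fun α => ?_⟩
    · exact (AddCommGrpCat.mono_iff_injective (e α).hom).1 inferInstance
    · exact (AddCommGrpCat.epi_iff_surjective (e α).hom).1 inferInstance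
  have hE' : Function.Bijective e'.hom.hom :=
    ⟨(AddCommGrpCat.mono_iff_injective e'.hom).1 inferInstance,
      (AddCommGrpCat.epi_iff_surjective e'.hom).1 inferInstance⟩
  have h : DirectSum.toAddMonoid (fun α => ((e α).hom ≫ g α ≫ e'.hom).hom) =
      e'.hom.hom.comp ((DirectSum.toAddMonoid fun α => (g α).hom).comp E) := by
    refine DirectSum.addHom_ext fun α a => ?_
    simp [E]
  rw [h]
  exact hE'.comp (hg.comp hE)

end CanonicalMap

end

end OmegaKappa

theorem mainTheorem7 (κ : Type u)
    (h : ∀ ℐ : OmegaKappa.OmegaSystem κ, ℐ.IsInjective →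
      ∀ (m : ℕ) (Φ : OmegaKappa.Cochain (OmegaKappa.prodSystem ℐ) m),
        OmegaKappa.IsCoherent ℐ m Φ → OmegaKappa.IsTrivial ℐ m Φ)
    (𝒢 : OmegaKappa.OmegaSystem κ) (n : ℕ) :
    Function.Bijective (OmegaKappa.canonicalMap 𝒢 n) := by
  have h1 := OmegaKappa.bijective_toAddMonoid_of_iso
    (fun α => (injectiveResolution (𝒢 α)).isoRightDerivedObj
      (lim : OmegaKappa.InvSystem.{u} ℕ ⥤ AddCommGrpCat.{u}) n)
    ((injectiveResolution (OmegaKappa.sumSystem 𝒢)).isoRightDerivedObj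
      (lim : OmegaKappa.InvSystem.{u} (κ → ℕ) ⥤ AddCommGrpCat.{u}) n).symm
    (fun α => HomologicalComplex.homologyMap (OmegaKappa.limResolutionMap 𝒢 α) n)
    (OmegaKappa.bijective_homologyMap_limResolutionMap 𝒢 h n)
  have h2 : OmegaKappa.canonicalComponent 𝒢 n = fun α => _ :=
    funext fun α => OmegaKappa.canonicalComponent_eq 𝒢 n α
  rw [OmegaKappa.canonicalMap, h2]
  exact h1
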